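/- Conventions: all spaces are complex, and $n$ ranges over the positive integers. For a normed space $E$ with dual $E'$, for $1\le p<\infty$ and $x_1,\dots,x_n\in E$, let \[ \mu_{p,n}(x_1,\dots,x_n)=\sup\Big\{\Big(\sum_{i=1}^n|\langle x_i,\lambda\rangle|^p\Big)^{1/p} : \lambda\in E',\ \|\lambda\|\le 1\Big\} \] be the weak $p$-summing norm. For $1\le p\le q<\infty$, the $(p,q)$-multi-norm based on $E$ is given by \[ \|(x_1,\dots,x_n)\|^{(p,q)}_n=\sup\Big\{\Big(\sum_{i=1}^n|\langle x_i,\lambda_i\rangle|^q\Big)^{1/q} : \lambda_1,\dots,\lambda_n\in E',\ \mu_{p,n}(\lambda_1,\dots,\lambda_n)\le 1\Big\}, \] and its rate of growth is the sequence \[ \varphi^{(p,q)}_n(E)=\sup\{\|(x_1,\dots,x_n)\|^{(p,q)}_n : x_1,\dots,x_n\in E,\ \|x_i\|\le 1\}. \] For sequences of non-negative numbers, $\alpha_n\sim\beta_n$ means that there are constants $C_1,C_2>0$ with $C_1\alpha_n\le\beta_n\le C_2\alpha_n$ for all $n\ge1$. Theorem. Let $\Omega$ be a measure space and let $1<r<\infty$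 be such that $L^r(\Omega)$ is infinite-dimensional. Set $\bar r=\min\{r,2\}$, and suppose that $1\le p\le q<\infty$. Then: (i) $\varphi^{(p,q)}_n(L^r(\Omega))\sim 1$ when $1/p-1/q\ge 1/\bar r$; (ii) $\varphi^{(p,q)}_n(L^r(\Omega))=n^{1/q}$ for all $n\ge 1$ when $p\ge\bar r$; (iii) $\varphi^{(p,q)}_n(L^r(\Omega))\sim n^{1/\bar r-1/p+1/q}$ when $1/p-1/q\le 1/\bar r$ and $p\le\bar r$. If $r=2$, then all three estimates are equalities for all $n\ge1$: $\varphi^{(p,q)}_n(L^2(\Omega))$ equals $1$, $n^{1/q}$ and $n^{1/2-1/p+1/q}$, respectively, under the conditions of (i), (ii) and (iii). -/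

import Mathlib

open MeasureTheory
open scoped ENNReal NNReal

noncomputable section

/-- The weak `p`-summing norm `μ_{p,n}(x₁, …, xₙ)`: the supremum of `(∑ᵢ |⟨xᵢ, f⟩|ᵖ)^{1/p}` over the
functionals `f` in the closed unit ball of the dual of `E`, as an extended nonnegative real. -/
def weakSummingNorm {E : Type*} [NormedAddCommGroup E] [NormedSpace ℂ E]
    (p : ℝ) {n : ℕ} (x : Fin n → E) : ℝ≥0∞ :=
  ⨆ (f : StrongDual ℂ E) (_ : ‖f‖ ≤ 1), (∑ i, ‖f (x i)‖ₑ ^ p) ^ (1 / p)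

/-- The `(p,q)`-multi-norm `‖(x₁, …, xₙ)‖ₙ^{(p,q)}`: the supremum of `(∑ᵢ |⟨xᵢ, fᵢ⟩|^q)^{1/q}` over
the tuples `(f₁, …, fₙ)` of functionals with `μ_{p,n}(f₁, …, fₙ) ≤ 1`, where the weak `p`-summing
norm is taken in the dual of `E`. -/
def pqMultiNorm {E : Type*} [NormedAddCommGroup E] [NormedSpace ℂ E]
    (p q : ℝ) {n : ℕ} (x : Fin n → E) : ℝ≥0∞ :=
  ⨆ (f : Fin n → StrongDual ℂ E) (_ : weakSummingNorm p f ≤ 1),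
    (∑ i, ‖f i (x i)‖ₑ ^ q) ^ (1 / q)

/-- The rate of growth `φₙ^{(p,q)}(E)` of the `(p,q)`-multi-norm based on `E`: the supremum of
`‖(x₁, …, xₙ)‖ₙ^{(p,q)}` over `x₁, …, xₙ` in the closed unit ball of `E`. -/
def pqGrowth (E : Type*) [NormedAddCommGroup E] [NormedSpace ℂ E]
    (p q : ℝ) (n : ℕ) : ℝ≥0∞ :=
  ⨆ (x : Fin n → E) (_ : ∀ i, ‖x i‖ ≤ 1), pqMultiNorm p q x

/-- Similarity `aₙ ∼ bₙ` of two sequences indexed by the positive integers: each is bounded by a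
positive (finite) constant times the other. -/
def SimilarSeq (a b : ℕ → ℝ≥0∞) : Prop :=
  ∃ C₁ C₂ : ℝ≥0, 0 < C₁ ∧ 0 < C₂ ∧
    ∀ n : ℕ, 1 ≤ n → (C₁ : ℝ≥0∞) * a n ≤ b n ∧ b n ≤ (C₂ : ℝ≥0∞) * a n

end

/-! ### Finite `ℓ^p` inequalities -/

/-! Put `τ = min r 2`. The growth is squeezed between two properties of `L^r`: Rademacher type `τ`,
and weakly `τ`-summing systems of almost normalised functionals.

Upper bounds: if the `fᵢ` have weak `p`-summing norm at most one and `‖xᵢ‖ ≤ 1`, rescale both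
families by powers of `|fᵢ(xᵢ)|` and average `(∑ εᵢ φᵢ)(∑ εⱼ yⱼ)` over signs. Only the diagonal
survives; Hölder bounds the first factor and type bounds the second, so `(∑ |fᵢ(xᵢ)|^s)^{1/s} ≤ T`
for `1/s = 1/p - 1/τ` (`HasRademacherType.rpow_sum_le`). Comparing `ℓ^q` with `ℓ^s` gives cases (i)
and (iii). Type `τ` comes from integrating a pointwise Khinchine inequality. Its constant is `T = 1`
for `r ≤ 2`, whence the equalities for `r = 2`. In case (ii) the bound `n^{1/q}` is trivial.

Lower bounds: infinite dimension yields arbitrarily many disjoint sets of positive finite measure,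
hence copies of `ℓ^r_N` in `L^r` with biorthogonal functionals spanning `ℓ^s_N`, where `s` is now
conjugate to `r`. For `r ≤ 2` these functionals themselves form the system. For `r ≥ 2` one uses
nearly isometric copies of `ℓ^2_n` in `ℓ^s_N`, found by unitary invariance
(`exists_approx_isometry_matrix`). Rescaling the system turns weak `τ`-summability into weak
`p`-summability (`hasWeakSummingSystems_Lp`, `HasWeakSummingSystems.rpow_sub_le_pqGrowth`). -/

theorem rpow_sum_rpow_anti {ι : Type*} [Fintype ι] {f : ι → ℝ} (hf : ∀ i, 0 ≤ f i)
    {a b : ℝ} (ha : 0 < a) (hab : a ≤ b) :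
    (∑ i, f i ^ b) ^ (1 / b) ≤ (∑ i, f i ^ a) ^ (1 / a) := by
  have hb : 0 < b := ha.trans_le hab
  have hS : 0 ≤ ∑ i, f i ^ a := Finset.sum_nonneg fun i _ => Real.rpow_nonneg (hf i) _
  set M := (∑ i, f i ^ a) ^ (1 / a) with hM
  have hM0 : 0 ≤ M := Real.rpow_nonneg hS _
  have hMa : M ^ a = ∑ i, f i ^ a := by
    rw [hM, ← Real.rpow_mul hS, one_div_mul_cancel ha.ne', Real.rpow_one]
  have hfM : ∀ i, f i ≤ M := fun i => by
    rw [← Real.rpow_le_rpow_iff (hf i) hM0 ha, hMa]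
    exact Finset.single_le_sum (f := fun i => f i ^ a)
      (fun j _ => Real.rpow_nonneg (hf j) _) (Finset.mem_univ i)
  have key : ∑ i, f i ^ b ≤ M ^ b := by
    calc ∑ i, f i ^ b = ∑ i, f i ^ a * f i ^ (b - a) := by
          refine Finset.sum_congr rfl fun i _ => ?_
          rw [← Real.rpow_add_of_nonneg (hf i) ha.le (by linarith)]
          congr 1; ring
      _ ≤ ∑ i, f i ^ a * M ^ (b - a) := by
          refine Finset.sum_le_sum fun i _ => ?_
          exact mul_le_mul_of_nonneg_left (Real.rpow_le_rpow (hf i) (hfM i) (by linarith))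
            (Real.rpow_nonneg (hf i) _)
      _ = M ^ b := by
          rw [← Finset.sum_mul, ← hMa, ← Real.rpow_add_of_nonneg hM0 ha.le (by linarith)]
          congr 1; ring
  calc (∑ i, f i ^ b) ^ (1 / b) ≤ (M ^ b) ^ (1 / b) :=
        Real.rpow_le_rpow (Finset.sum_nonneg fun i _ => Real.rpow_nonneg (hf i) _) key
          (by positivity)
    _ = M := by rw [← Real.rpow_mul hM0, mul_one_div_cancel hb.ne', Real.rpow_one]

theorem rpow_sum_rpow_le_card {ι : Type*} [Fintype ι] {f : ι → ℝ} (hf : ∀ i, 0 ≤ f i)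
    {a b : ℝ} (ha : 0 < a) (hab : a ≤ b) :
    (∑ i, f i ^ a) ^ (1 / a)
      ≤ (Fintype.card ι : ℝ) ^ (1 / a - 1 / b) * (∑ i, f i ^ b) ^ (1 / b) := by
  have hb : 0 < b := ha.trans_le hab
  have hS : 0 ≤ ∑ i, f i ^ a := Finset.sum_nonneg fun i _ => Real.rpow_nonneg (hf i) _
  have hS' : 0 ≤ ∑ i, f i ^ b := Finset.sum_nonneg fun i _ => Real.rpow_nonneg (hf i) _
  have h := Real.rpow_sum_le_const_mul_sum_rpow Finset.univ (fun i => f i ^ a)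
    (p := b / a) ((one_le_div ha).2 hab)
  have e1 : ∀ i, |f i ^ a| = f i ^ a := fun i => abs_of_nonneg (Real.rpow_nonneg (hf i) _)
  have e2 : ∀ i, (f i ^ a) ^ (b / a) = f i ^ b := fun i => by
    rw [← Real.rpow_mul (hf i), mul_div_cancel₀ _ ha.ne']
  simp only [e1, e2, Finset.card_univ] at h
  have h2 := Real.rpow_le_rpow (Real.rpow_nonneg hS _) h (show 0 ≤ 1 / b by positivity)
  rw [← Real.rpow_mul hS, Real.mul_rpow (by positivity) hS', ← Real.rpow_mul (by positivity)] at h2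
  have e3 : b / a * (1 / b) = 1 / a := by field_simp
  have e4 : (b / a - 1) * (1 / b) = 1 / a - 1 / b := by field_simp
  rwa [e3, e4] at h2

theorem rpow_sum_enorm_eq_ofReal {ι : Type*} [Fintype ι] {F : Type*} [SeminormedAddCommGroup F]
    (z : ι → F) {q : ℝ} (hq : 0 < q) :
    (∑ i, ‖z i‖ₑ ^ q) ^ (1 / q) = ENNReal.ofReal ((∑ i, ‖z i‖ ^ q) ^ (1 / q)) := by
  rw [← ENNReal.ofReal_rpow_of_nonneg (Finset.sum_nonneg fun i _ => by positivity) (by positivity),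
    ENNReal.ofReal_sum_of_nonneg fun i _ => by positivity]
  congr 1
  refine Finset.sum_congr rfl fun i _ => ?_
  rw [← ENNReal.ofReal_rpow_of_nonneg (norm_nonneg _) hq.le, ofReal_norm]

/-! ### The weak summing norm -/

section General

variable {E : Type*} [NormedAddCommGroup E] [NormedSpace ℂ E]

theorem weakSummingNorm_le_one_iff {p : ℝ} (hp : 0 < p) {n : ℕ} (x : Fin n → E) :
    weakSummingNorm p x ≤ 1 ↔ ∀ f : StrongDual ℂ E, ‖f‖ ≤ 1 → ∑ i, ‖f (x i)‖ ^ p ≤ 1 := by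
  unfold weakSummingNorm
  simp only [iSup_le_iff]
  refine forall₂_congr fun f _ => ?_
  have h0 : 0 ≤ ∑ i, ‖f (x i)‖ ^ p := Finset.sum_nonneg fun i _ => by positivity
  have h1 := Real.rpow_le_rpow_iff h0 zero_le_one (show 0 < 1 / p by positivity)
  rw [Real.one_rpow] at h1
  rw [rpow_sum_enorm_eq_ofReal _ hp, ENNReal.ofReal_le_one, h1]

/-- Evaluations at points of `E` lie in the bidual unit ball. The upper bounds use no other elements
of the bidual, so reflexivity plays no role. -/
theorem sum_apply_rpow_le_one {p : ℝ} (hp : 0 < p) {n : ℕ} {f : Fin n → StrongDual ℂ E}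
    (hf : weakSummingNorm p f ≤ 1) {x : E} (hx : ‖x‖ ≤ 1) : ∑ i, ‖f i x‖ ^ p ≤ 1 := by
  refine (weakSummingNorm_le_one_iff hp f).1 hf (NormedSpace.inclusionInDoubleDual ℂ E x) ?_
  exact (NormedSpace.double_dual_bound ℂ E x).trans hx

end General

/-! ### Averages over signs -/

/-- The complex number attached to a sign. -/
def signC (u : ℤˣ) : ℂ := ((u : ℤ) : ℂ)

@[simp] theorem signC_one : signC 1 = 1 := by simp [signC]

@[simp] theorem signC_neg (u : ℤˣ) : signC (-u) = -signC u := by simp [signC]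

@[simp] theorem norm_signC (u : ℤˣ) : ‖signC u‖ = 1 := by
  rcases Int.units_eq_one_or u with rfl | rfl <;> simp

theorem signC_mul_self (u : ℤˣ) : signC u * signC u = 1 := by
  rcases Int.units_eq_one_or u with rfl | rfl <;> simp

theorem sum_signC_mul_signC {n : ℕ} (i j : Fin n) :
    ∑ ε : Fin n → ℤˣ, signC (ε i) * signC (ε j)
      = if i = j then (Fintype.card (Fin n → ℤˣ) : ℂ) else 0 := by
  split_ifs with h
  · subst h
    simp [signC_mul_self]
  -- Flipping the `i`-th sign permutes the cube and negates each summand, so the sum equals its own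
  -- negative.
  · have e := Equiv.sum_comp (Equiv.mulLeft (Function.update (1 : Fin n → ℤˣ) i (-1)))
      (fun ε : Fin n → ℤˣ => signC (ε i) * signC (ε j))
    have e2 : ∀ ε : Fin n → ℤˣ,
        signC ((Equiv.mulLeft (Function.update (1 : Fin n → ℤˣ) i (-1)) ε) i)
          * signC ((Equiv.mulLeft (Function.update (1 : Fin n → ℤˣ) i (-1)) ε) j)
        = -(signC (ε i) * signC (ε j)) := fun ε => by
      simp [Function.update_of_ne (Ne.symm h)]
    simp only [e2, Finset.sum_neg_distrib] at e
    exact self_eq_neg.1 e.symm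

theorem sum_sign_apply_sum_sign {E : Type*} [NormedAddCommGroup E] [NormedSpace ℂ E] {n : ℕ}
    (f : Fin n → StrongDual ℂ E) (y : Fin n → E) :
    ∑ ε : Fin n → ℤˣ, (∑ i, signC (ε i) • f i) (∑ j, signC (ε j) • y j)
      = Fintype.card (Fin n → ℤˣ) * ∑ i, f i (y i) := by
  have h : ∀ ε : Fin n → ℤˣ, (∑ i, signC (ε i) • f i) (∑ j, signC (ε j) • y j)
      = ∑ i, ∑ j, (signC (ε i) * signC (ε j)) * f i (y j) := fun ε => by
    simp only [map_sum, map_smul, _root_.sum_apply, _root_.smul_apply,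
      smul_eq_mul, Finset.mul_sum]
    rw [Finset.sum_comm]
    refine Finset.sum_congr rfl fun i _ => Finset.sum_congr rfl fun j _ => by ring
  simp only [h]
  rw [Finset.sum_comm, Finset.mul_sum]
  refine Finset.sum_congr rfl fun i _ => ?_
  rw [Finset.sum_comm]
  simp only [← Finset.sum_mul, sum_signC_mul_signC, ite_mul, zero_mul]
  simp

/-- `E` has Rademacher type `τ` with constant `T`. -/
def HasRademacherType (E : Type*) [NormedAddCommGroup E] [NormedSpace ℂ E] (τ T : ℝ) : Prop :=
  ∀ (n : ℕ) (y : Fin n → E), ∑ ε : Fin n → ℤˣ, ‖∑ i, signC (ε i) • y i‖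
    ≤ Fintype.card (Fin n → ℤˣ) * (T * (∑ i, ‖y i‖ ^ τ) ^ (1 / τ))

/-- Hölder with exponents `p'` and `p`, where `1 - 1/p = 1/p'`; the case `p = 1` is separate because
`p'` is then infinite. -/
theorem sum_rpow_mul_le {ι : Type*} [Fintype ι] {m b : ι → ℝ} (hm : ∀ i, 0 ≤ m i)
    (hb : ∀ i, 0 ≤ b i) {p q : ℝ} (hp : 1 ≤ p) (hbp : ∑ i, b i ^ p ≤ 1) :
    ∑ i, m i ^ (q * (1 - 1 / p)) * b i ≤ (∑ i, m i ^ q) ^ (1 - 1 / p) := by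
  have h0 : 0 ≤ ∑ i, b i ^ p := Finset.sum_nonneg fun i _ => Real.rpow_nonneg (hb i) _
  rcases hp.eq_or_lt with rfl | hp1
  · simpa using hbp
  · have hc := (Real.HolderConjugate.conjExponent hp1).symm
    have hone : 1 / p.conjExponent = 1 - 1 / p := by
      have := hc.inv_add_inv_eq_one
      simp only [one_div]; linarith
    have h := Real.inner_le_Lp_mul_Lq_of_nonneg Finset.univ (f := fun i => m i ^ (q * (1 - 1 / p)))
      (g := b) hc (fun i _ => Real.rpow_nonneg (hm i) _) (fun i _ => hb i)
    refine h.trans ?_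
    have e : ∀ i, (m i ^ (q * (1 - 1 / p))) ^ p.conjExponent = m i ^ q := fun i => by
      rw [← Real.rpow_mul (hm i), ← hone, mul_assoc, one_div_mul_cancel hc.ne_zero, mul_one]
    simp only [e, hone]
    refine mul_le_of_le_one_right (Real.rpow_nonneg
      (Finset.sum_nonneg fun i _ => Real.rpow_nonneg (hm i) _) _) ?_
    exact Real.rpow_le_one h0 hbp (by positivity)

/-- At `w = 0` the quotient is `0` by the division convention, hence a bound on `‖u‖` and not an
equality. -/
theorem exists_phase (w : ℂ) : ∃ u : ℂ, ‖u‖ ≤ 1 ∧ u * w = ‖w‖ := by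
  refine ⟨(starRingEnd ℂ) w / ‖w‖, ?_, ?_⟩
  · rw [norm_div, RCLike.norm_conj, Complex.norm_real, Real.norm_eq_abs,
      abs_of_nonneg (norm_nonneg w)]
    exact div_self_le_one _
  · by_cases hw : w = 0
    · simp [hw]
    · rw [div_mul_eq_mul_div, Complex.conj_mul', div_eq_iff (by exact_mod_cast norm_ne_zero_iff.2 hw),
        sq]

/-! ### Rademacher type bounds the diagonal sums -/

section General

variable {E : Type*} [NormedAddCommGroup E] [NormedSpace ℂ E]

theorem HasRademacherType.rpow_sum_le {τ T p q : ℝ} (hE : HasRademacherType E τ T) (hT : 0 ≤ T)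
    (hτ : 0 < τ) (hp : 1 ≤ p) (hq : 0 < q) (hpq : 1 / q = 1 / p - 1 / τ) {n : ℕ}
    {f : Fin n → StrongDual ℂ E} (hf : weakSummingNorm p f ≤ 1) {x : Fin n → E}
    (hx : ∀ i, ‖x i‖ ≤ 1) :
    (∑ i, ‖f i (x i)‖ ^ q) ^ (1 / q) ≤ T := by
  set m : Fin n → ℝ := fun i => ‖f i (x i)‖ with hm_def
  have hm : ∀ i, 0 ≤ m i := fun i => norm_nonneg _
  set S := ∑ i, m i ^ q with hS
  have hS0 : 0 ≤ S := Finset.sum_nonneg fun i _ => Real.rpow_nonneg (hm i) _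
  have hp0 : 0 < p := by linarith
  have hp1 : 0 ≤ 1 - 1 / p := by
    have : 1 / p ≤ 1 := by rw [div_le_one hp0]; exact hp
    linarith
  rcases hS0.eq_or_lt with h0 | hSpos
  · change S ^ (1 / q) ≤ T
    rw [← h0, Real.zero_rpow (by positivity)]; exact hT
  have hphase : ∀ i, ∃ u : ℂ, ‖u‖ ≤ 1 ∧ u * f i (x i) = m i := fun i => exists_phase _
  choose u hu1 hu2 using hphase
  -- The weights are chosen so that `‖∑ εᵢ φᵢ‖ ≤ S^{1-1/p}`, `∑ ‖yᵢ‖^τ ≤ S` and `φᵢ(yᵢ) = mᵢ^q`; the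
  -- last holds because `q(1 - 1/p) + q/τ + 1 = q`.
  set φ : Fin n → StrongDual ℂ E := fun i => ((m i ^ (q * (1 - 1 / p)) : ℝ) : ℂ) • f i with hφ
  set y : Fin n → E := fun i => (((m i ^ (q / τ) : ℝ) : ℂ) * u i) • x i with hy
  have hφn : ∀ ε : Fin n → ℤˣ, ‖∑ i, signC (ε i) • φ i‖ ≤ S ^ (1 - 1 / p) := fun ε => by
    refine ContinuousLinearMap.opNorm_le_of_unit_norm (𝕜 := ℂ) ?_ ?_
    · positivity
    · intro z hz
      have hz' := sum_apply_rpow_le_one hp0 hf hz.le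
      have h2 := sum_rpow_mul_le (q := q) hm (b := fun i => ‖f i z‖) (fun i => norm_nonneg _) hp hz'
      refine le_trans ?_ h2
      rw [_root_.sum_apply]
      refine (norm_sum_le _ _).trans (Finset.sum_le_sum fun i _ => ?_)
      simp only [hφ, _root_.smul_apply, smul_eq_mul, norm_mul, norm_signC, one_mul,
        Complex.norm_real, Real.norm_eq_abs, abs_of_nonneg (Real.rpow_nonneg (hm i) _), le_refl]
  have hyn : (∑ i, ‖y i‖ ^ τ) ^ (1 / τ) ≤ S ^ (1 / τ) := by
    refine Real.rpow_le_rpow (Finset.sum_nonneg fun i _ => by positivity)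
      (Finset.sum_le_sum fun i _ => ?_) (by positivity)
    have : ‖y i‖ ≤ m i ^ (q / τ) := by
      simp only [hy, norm_smul, norm_mul, Complex.norm_real, Real.norm_eq_abs,
        abs_of_nonneg (Real.rpow_nonneg (hm i) _)]
      have h1 := Real.rpow_nonneg (hm i) (q / τ)
      have h2 : m i ^ (q / τ) * ‖u i‖ ≤ m i ^ (q / τ) := mul_le_of_le_one_right h1 (hu1 i)
      exact (mul_le_of_le_one_right (by positivity) (hx i)).trans h2
    calc ‖y i‖ ^ τ ≤ (m i ^ (q / τ)) ^ τ := Real.rpow_le_rpow (norm_nonneg _) this hτ.le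
      _ = m i ^ q := by rw [← Real.rpow_mul (hm i), div_mul_cancel₀ _ hτ.ne']
  have hdiag : ∀ i, φ i (y i) = ((m i ^ q : ℝ) : ℂ) := fun i => by
    have : φ i (y i)
        = ((m i ^ (q * (1 - 1 / p)) : ℝ) : ℂ) * (((m i ^ (q / τ) : ℝ) : ℂ) * (u i * f i (x i))) := by
      simp only [hφ, hy, _root_.smul_apply, map_smul, smul_eq_mul]; ring
    rw [this, hu2, ← Complex.ofReal_mul, ← Complex.ofReal_mul]
    congr 1
    rcases (hm i).eq_or_lt with h0 | hpos
    · rw [← h0, Real.zero_rpow hq.ne']; simp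
    · have e1 : m i ^ (q / τ) * m i = m i ^ (q / τ + 1) := by
        rw [Real.rpow_add hpos, Real.rpow_one]
      rw [e1, ← Real.rpow_add hpos]
      congr 1
      have : q * (1 / q) = 1 := mul_one_div_cancel hq.ne'
      rw [hpq] at this
      have h3 : q / τ = q * (1 / τ) := by ring
      rw [h3]; linarith
  have hsum := sum_sign_apply_sum_sign φ y
  simp only [hdiag, ← Complex.ofReal_sum] at hsum
  have hcard : (0 : ℝ) < Fintype.card (Fin n → ℤˣ) := by exact_mod_cast Fintype.card_pos
  have hmain : (Fintype.card (Fin n → ℤˣ) : ℝ) * S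
      ≤ S ^ (1 - 1 / p) * (Fintype.card (Fin n → ℤˣ) * (T * S ^ (1 / τ))) := by
    have h1 : (Fintype.card (Fin n → ℤˣ) : ℝ) * S
        = ‖((Fintype.card (Fin n → ℤˣ) : ℝ) : ℂ) * (S : ℂ)‖ := by
      rw [← Complex.ofReal_mul, Complex.norm_real, Real.norm_eq_abs, abs_of_nonneg (by positivity)]
    rw [h1, Complex.ofReal_natCast, hS, ← hsum]
    calc ‖∑ ε : Fin n → ℤˣ, (∑ i, signC (ε i) • φ i) (∑ j, signC (ε j) • y j)‖
        ≤ ∑ ε : Fin n → ℤˣ, S ^ (1 - 1 / p) * ‖∑ j, signC (ε j) • y j‖ := by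
          refine (norm_sum_le _ _).trans (Finset.sum_le_sum fun ε _ => ?_)
          exact ContinuousLinearMap.le_of_opNorm_le _ (hφn ε) _
      _ = S ^ (1 - 1 / p) * ∑ ε : Fin n → ℤˣ, ‖∑ j, signC (ε j) • y j‖ := by
          rw [Finset.mul_sum]
      _ ≤ S ^ (1 - 1 / p) * (Fintype.card (Fin n → ℤˣ) * (T * S ^ (1 / τ))) := by
          refine mul_le_mul_of_nonneg_left ((hE n y).trans ?_) (by positivity)
          exact mul_le_mul_of_nonneg_left (mul_le_mul_of_nonneg_left hyn hT) hcard.le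
  -- Dividing this by `S^{1-1/q}` leaves the claim `S^{1/q} ≤ T`.
  have hfin : S ≤ T * S ^ (1 - 1 / q) := by
    have e : S ^ (1 - 1 / q) = S ^ (1 - 1 / p) * S ^ (1 / τ) := by
      rw [← Real.rpow_add hSpos, hpq]; congr 1; ring
    rw [e]
    have : (Fintype.card (Fin n → ℤˣ) : ℝ) * S
        ≤ (Fintype.card (Fin n → ℤˣ) : ℝ) * (T * (S ^ (1 - 1 / p) * S ^ (1 / τ))) :=
      hmain.trans (le_of_eq (by ring))
    exact le_of_mul_le_mul_left this hcard
  have hpos2 : 0 < S ^ (1 - 1 / q) := Real.rpow_pos_of_pos hSpos _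
  refine le_of_mul_le_mul_right ?_ hpos2
  rw [← Real.rpow_add hSpos]
  simpa using hfin

end General

/-! ### Khinchine's inequality -/

theorem sum_sign_norm_sq {n : ℕ} (z : Fin n → ℂ) :
    ∑ ε : Fin n → ℤˣ, ‖∑ i, signC (ε i) • z i‖ ^ (2 : ℝ)
      = Fintype.card (Fin n → ℤˣ) * ∑ i, ‖z i‖ ^ (2 : ℝ) := by
  have h := sum_sign_apply_sum_sign
    (fun i => (starRingEnd ℂ) (z i) • ContinuousLinearMap.id ℂ ℂ) z
  have e1 : ∀ ε : Fin n → ℤˣ,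
      (∑ i, signC (ε i) • (starRingEnd ℂ) (z i) • ContinuousLinearMap.id ℂ ℂ)
        (∑ j, signC (ε j) • z j) = ((‖∑ i, signC (ε i) • z i‖ ^ (2 : ℝ) : ℝ) : ℂ) := fun ε => by
    have e3 : ∀ u : ℤˣ, (starRingEnd ℂ) (signC u) = signC u := fun u => by
      rcases Int.units_eq_one_or u with rfl | rfl <;> simp
    have e4 : (∑ i, signC (ε i) • (starRingEnd ℂ) (z i) • ContinuousLinearMap.id ℂ ℂ)
        (∑ j, signC (ε j) • z j)
        = (starRingEnd ℂ) (∑ j, signC (ε j) • z j) * (∑ j, signC (ε j) • z j) := by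
      rw [_root_.sum_apply, map_sum, Finset.sum_mul]
      refine Finset.sum_congr rfl fun i _ => ?_
      simp [e3, mul_assoc, Finset.mul_sum]
    rw [e4, Complex.conj_mul', Real.rpow_two, Complex.ofReal_pow]
  have e2 : ∀ i, ((starRingEnd ℂ) (z i) • ContinuousLinearMap.id ℂ ℂ) (z i)
      = ((‖z i‖ ^ (2 : ℝ) : ℝ) : ℂ) := fun i => by
    simp [Complex.conj_mul']
  simp only [e1, e2] at h
  exact_mod_cast h

/-- The power mean over signs reduces to the second moment, which is exact by orthogonality; then
`ℓ^2 ≤ ℓ^r`. No constant is lost. -/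
theorem sum_sign_rpow_le_of_le_two {r : ℝ} (hr : 0 < r) (hr2 : r ≤ 2) {n : ℕ} (z : Fin n → ℂ) :
    ∑ ε : Fin n → ℤˣ, ‖∑ i, signC (ε i) • z i‖ ^ r
      ≤ Fintype.card (Fin n → ℤˣ) * ∑ i, ‖z i‖ ^ r := by
  have h1 := rpow_sum_rpow_le_card (f := fun ε : Fin n → ℤˣ => ‖∑ i, signC (ε i) • z i‖)
    (fun ε => norm_nonneg _) hr hr2
  have h2 := rpow_sum_rpow_anti (f := fun i => ‖z i‖) (fun i => norm_nonneg _) hr hr2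
  have hc : (0 : ℝ) < Fintype.card (Fin n → ℤˣ) := by exact_mod_cast Fintype.card_pos
  set C : ℝ := ((Fintype.card (Fin n → ℤˣ) : ℕ) : ℝ) with hC
  have hA : 0 ≤ ∑ ε : Fin n → ℤˣ, ‖∑ i, signC (ε i) • z i‖ ^ r :=
    Finset.sum_nonneg fun _ _ => by positivity
  have hB : 0 ≤ ∑ i, ‖z i‖ ^ r := Finset.sum_nonneg fun _ _ => by positivity
  have hB2 : 0 ≤ ∑ i, ‖z i‖ ^ (2 : ℝ) := Finset.sum_nonneg fun _ _ => by positivity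
  rw [sum_sign_norm_sq, Real.mul_rpow hc.le hB2, ← mul_assoc, ← Real.rpow_add hc,
    sub_add_cancel] at h1
  rw [← Real.rpow_le_rpow_iff hA (by positivity) (show 0 < 1 / r by positivity),
    Real.mul_rpow hc.le hB]
  exact h1.trans (mul_le_mul_of_nonneg_left h2 (by positivity))

theorem abs_rpow_le_exp {r : ℝ} (hr : 0 < r) (x : ℝ) :
    |x| ^ r ≤ r ^ r * (Real.exp x + Real.exp (-x)) := by
  have h1 : |x| / r ≤ Real.exp (|x| / r) := by linarith [Real.add_one_le_exp (|x| / r)]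
  have h2 := Real.rpow_le_rpow (by positivity) h1 hr.le
  rw [← Real.exp_mul, div_mul_cancel₀ _ hr.ne', Real.div_rpow (abs_nonneg x) hr.le,
    div_le_iff₀ (by positivity)] at h2
  have h3 : Real.exp |x| ≤ Real.exp x + Real.exp (-x) := by
    rcases abs_cases x with ⟨h, _⟩ | ⟨h, _⟩ <;> rw [h] <;>
      linarith [Real.exp_pos x, Real.exp_pos (-x)]
  calc |x| ^ r ≤ Real.exp |x| * r ^ r := h2
    _ ≤ r ^ r * (Real.exp x + Real.exp (-x)) := by
      rw [mul_comm]; exact mul_le_mul_of_nonneg_left h3 (by positivity)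

/-- The sum over the cube factors into terms `2 cosh bᵢ`, each at most `2 exp(bᵢ²/2)`. -/
theorem sum_sign_exp_le {n : ℕ} (b : Fin n → ℝ) :
    ∑ ε : Fin n → ℤˣ, Real.exp (∑ i, ((ε i : ℤ) : ℝ) * b i)
      ≤ Fintype.card (Fin n → ℤˣ) * Real.exp ((∑ i, b i ^ 2) / 2) := by
  have h1 : ∀ i, ∑ u : ℤˣ, Real.exp (((u : ℤ) : ℝ) * b i) ≤ 2 * Real.exp (b i ^ 2 / 2) :=
    fun i => by
    have hu : (Finset.univ : Finset ℤˣ) = {1, -1} := rfl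
    have := Real.cosh_le_exp_half_sq (b i)
    rw [Real.cosh_eq] at this
    rw [hu, Finset.sum_pair (by decide)]
    simp only [Units.val_one, Int.cast_one, one_mul, Units.val_neg, Int.cast_neg, neg_mul]
    linarith
  calc ∑ ε : Fin n → ℤˣ, Real.exp (∑ i, ((ε i : ℤ) : ℝ) * b i)
      = ∏ i, ∑ u : ℤˣ, Real.exp (((u : ℤ) : ℝ) * b i) := by
        rw [Fintype.prod_sum]
        simp only [Real.exp_sum]
    _ ≤ ∏ i, 2 * Real.exp (b i ^ 2 / 2) :=
        Finset.prod_le_prod (fun i _ => Finset.sum_nonneg fun _ _ => (Real.exp_pos _).le)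
          fun i _ => h1 i
    _ = Fintype.card (Fin n → ℤˣ) * Real.exp ((∑ i, b i ^ 2) / 2) := by
        rw [Finset.prod_mul_distrib, ← Real.exp_sum, Finset.sum_div]
        simp

/-- After normalising to `∑ aᵢ² = 1`, the `r`-th power is dominated by `r^r (e^x + e^{-x})`, and
each exponential averages to at most `e^{1/2}`. -/
theorem sum_sign_abs_rpow_le {r : ℝ} (hr : 0 < r) {n : ℕ} (a : Fin n → ℝ) :
    ∑ ε : Fin n → ℤˣ, |∑ i, ((ε i : ℤ) : ℝ) * a i| ^ r
      ≤ Fintype.card (Fin n → ℤˣ) * ((r ^ r * (2 * Real.exp (1 / 2))) * (∑ i, a i ^ 2) ^ (r / 2)) := by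
  have hS : 0 ≤ ∑ i, a i ^ 2 := Finset.sum_nonneg fun i _ => sq_nonneg _
  rcases hS.eq_or_lt with h0 | hpos
  · have ha : ∀ i, a i = 0 := fun i => by
      have := (Finset.sum_eq_zero_iff_of_nonneg fun i _ => sq_nonneg (a i)).1 h0.symm i
        (Finset.mem_univ i)
      exact pow_eq_zero_iff two_ne_zero |>.1 this
    simp only [ha, mul_zero, Finset.sum_const_zero, abs_zero, Real.zero_rpow hr.ne']
    positivity
  · set s := Real.sqrt (∑ i, a i ^ 2) with hs
    have hs0 : 0 < s := Real.sqrt_pos.2 hpos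
    have hs2 : s ^ 2 = ∑ i, a i ^ 2 := Real.sq_sqrt hS
    have hsr : s ^ r = (∑ i, a i ^ 2) ^ (r / 2) := by
      rw [← hs2, ← Real.rpow_natCast, ← Real.rpow_mul hs0.le]; congr 1; push_cast; ring
    have hb : ∑ i, (a i / s) ^ 2 = 1 := by
      simp only [div_pow, ← Finset.sum_div, ← hs2]; exact div_self (by positivity)
    have hb' : ∑ i, (-(a i / s)) ^ 2 = 1 := by simpa using hb
    have h1 := sum_sign_exp_le fun i => a i / s
    have h2 := sum_sign_exp_le fun i => -(a i / s)
    rw [hb] at h1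
    rw [hb'] at h2
    simp only [mul_neg, Finset.sum_neg_distrib] at h2
    have h3 : ∀ ε : Fin n → ℤˣ, |∑ i, ((ε i : ℤ) : ℝ) * a i| ^ r
        ≤ s ^ r * (r ^ r * (Real.exp (∑ i, ((ε i : ℤ) : ℝ) * (a i / s))
          + Real.exp (-∑ i, ((ε i : ℤ) : ℝ) * (a i / s)))) := fun ε => by
      have e : ∑ i, ((ε i : ℤ) : ℝ) * a i = s * ∑ i, ((ε i : ℤ) : ℝ) * (a i / s) := by
        rw [Finset.mul_sum]
        refine Finset.sum_congr rfl fun i _ => ?_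
        field_simp
      rw [e, abs_mul, abs_of_pos hs0, Real.mul_rpow hs0.le (abs_nonneg _)]
      exact mul_le_mul_of_nonneg_left (abs_rpow_le_exp hr _) (by positivity)
    refine (Finset.sum_le_sum fun ε _ => h3 ε).trans ?_
    rw [← Finset.mul_sum, ← Finset.mul_sum, Finset.sum_add_distrib, hsr]
    refine (mul_le_mul_of_nonneg_left (mul_le_mul_of_nonneg_left (add_le_add h1 h2)
      (by positivity)) (by positivity)).trans (le_of_eq ?_)
    ring

/-- Real and imaginary parts are treated separately: convexity costs `2^{r-1}` and the two parts a
further factor `2`. -/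
theorem sum_sign_rpow_le {r : ℝ} (hr : 1 ≤ r) {n : ℕ} (z : Fin n → ℂ) :
    ∑ ε : Fin n → ℤˣ, ‖∑ i, signC (ε i) • z i‖ ^ r
      ≤ Fintype.card (Fin n → ℤˣ) *
        ((2 ^ r * (r ^ r * (2 * Real.exp (1 / 2)))) * (∑ i, ‖z i‖ ^ (2 : ℝ)) ^ (r / 2)) := by
  have hr0 : 0 < r := by linarith
  have hK : 0 ≤ r ^ r * (2 * Real.exp (1 / 2)) := by positivity
  have hpt : ∀ ε : Fin n → ℤˣ, ‖∑ i, signC (ε i) • z i‖ ^ r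
      ≤ 2 ^ (r - 1) * (|∑ i, ((ε i : ℤ) : ℝ) * (z i).re| ^ r
        + |∑ i, ((ε i : ℤ) : ℝ) * (z i).im| ^ r) := fun ε => by
    have e1 : (∑ i, signC (ε i) • z i).re = ∑ i, ((ε i : ℤ) : ℝ) * (z i).re := by
      rw [Complex.re_sum]
      exact Finset.sum_congr rfl fun i _ => by simp [signC]
    have e2 : (∑ i, signC (ε i) • z i).im = ∑ i, ((ε i : ℤ) : ℝ) * (z i).im := by
      rw [Complex.im_sum]
      exact Finset.sum_congr rfl fun i _ => by simp [signC]
    have h := Complex.norm_le_abs_re_add_abs_im (∑ i, signC (ε i) • z i)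
    rw [e1, e2] at h
    refine (Real.rpow_le_rpow (norm_nonneg _) h hr0.le).trans ?_
    exact_mod_cast NNReal.rpow_add_le_mul_rpow_add_rpow
      ⟨_, abs_nonneg (∑ i, ((ε i : ℤ) : ℝ) * (z i).re)⟩
      ⟨_, abs_nonneg (∑ i, ((ε i : ℤ) : ℝ) * (z i).im)⟩ hr
  have hle : ∀ g : ℂ → ℝ, (∀ w, |g w| ≤ ‖w‖) →
      (∑ i, (g (z i)) ^ 2) ^ (r / 2) ≤ (∑ i, ‖z i‖ ^ (2 : ℝ)) ^ (r / 2) := fun g hg => by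
    refine Real.rpow_le_rpow (Finset.sum_nonneg fun i _ => sq_nonneg _)
      (Finset.sum_le_sum fun i _ => ?_) (by positivity)
    rw [Real.rpow_two, ← sq_abs]
    exact pow_le_pow_left₀ (abs_nonneg _) (hg _) 2
  have h1 := (sum_sign_abs_rpow_le hr0 fun i => (z i).re).trans
    (mul_le_mul_of_nonneg_left (mul_le_mul_of_nonneg_left
      (hle Complex.re Complex.abs_re_le_norm) hK) (Nat.cast_nonneg _))
  have h2 := (sum_sign_abs_rpow_le hr0 fun i => (z i).im).trans
    (mul_le_mul_of_nonneg_left (mul_le_mul_of_nonneg_left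
      (hle Complex.im Complex.abs_im_le_norm) hK) (Nat.cast_nonneg _))
  refine (Finset.sum_le_sum fun ε _ => hpt ε).trans ?_
  rw [← Finset.mul_sum, Finset.sum_add_distrib]
  have h2r : (2 : ℝ) ^ r = 2 ^ (r - 1) * 2 := by
    rw [← Real.rpow_add_one two_ne_zero]; congr 1; ring
  calc (2 : ℝ) ^ (r - 1) * (_ + _) ≤ 2 ^ (r - 1) * (_ + _) :=
        mul_le_mul_of_nonneg_left (add_le_add h1 h2) (by positivity)
    _ = _ := by rw [h2r]; ring

/-! ### The Rademacher type of `L^r` -/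

/-- Passes from the `r`-th moment, which commutes with integration in `L^r`, to the first moment
used in the definition of type. -/
theorem sum_norm_le_of_sum_rpow_le {ι : Type*} [Fintype ι] {w : ι → ℝ} (hw : ∀ i, 0 ≤ w i)
    {r K : ℝ} (hr : 1 ≤ r) (hK : 0 ≤ K) (h : ∑ i, w i ^ r ≤ Fintype.card ι * K ^ r) :
    ∑ i, w i ≤ Fintype.card ι * K := by
  have hr0 : 0 < r := by linarith
  have h1 := rpow_sum_rpow_le_card hw zero_lt_one hr
  simp only [Real.rpow_one, div_one] at h1
  refine h1.trans ?_
  rcases (Nat.cast_nonneg (α := ℝ) (Fintype.card ι)).eq_or_lt with h0 | hpos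
  · have : IsEmpty ι := Fintype.card_eq_zero_iff.1 (by exact_mod_cast h0.symm)
    simp [Real.zero_rpow (inv_ne_zero hr0.ne')]
  · have h2 := Real.rpow_le_rpow (Finset.sum_nonneg fun i _ => Real.rpow_nonneg (hw i) _) h
      (show 0 ≤ 1 / r by positivity)
    rw [Real.mul_rpow hpos.le (by positivity), ← Real.rpow_mul hK, mul_one_div_cancel hr0.ne',
      Real.rpow_one] at h2
    calc (Fintype.card ι : ℝ) ^ (1 - 1 / r) * (∑ i, w i ^ r) ^ (1 / r)
        ≤ (Fintype.card ι : ℝ) ^ (1 - 1 / r) * ((Fintype.card ι : ℝ) ^ (1 / r) * K) :=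
          mul_le_mul_of_nonneg_left h2 (by positivity)
      _ = Fintype.card ι * K := by
          rw [← mul_assoc, ← Real.rpow_add hpos, sub_add_cancel, Real.rpow_one]

theorem sum_enorm_rpow_eq_ofReal {ι : Type*} [Fintype ι] {F : Type*} [SeminormedAddCommGroup F]
    (z : ι → F) {q : ℝ} (hq : 0 < q) :
    ∑ i, ‖z i‖ₑ ^ q = ENNReal.ofReal (∑ i, ‖z i‖ ^ q) := by
  rw [ENNReal.ofReal_sum_of_nonneg fun i _ => by positivity]
  refine Finset.sum_congr rfl fun i _ => ?_
  rw [← ENNReal.ofReal_rpow_of_nonneg (norm_nonneg _) hq.le, ofReal_norm]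

section Lr

variable {Ω : Type*} [MeasurableSpace Ω] {μ : Measure Ω} {r : ℝ}

theorem Lp_enorm_rpow (hr : 0 < r) (f : Lp ℂ (ENNReal.ofReal r) μ) :
    ‖f‖ₑ ^ r = ∫⁻ t, ‖f t‖ₑ ^ r ∂μ := by
  rw [Lp.enorm_def, eLpNorm_eq_lintegral_rpow_enorm_toReal (by simpa using hr)
    ENNReal.ofReal_ne_top, ENNReal.toReal_ofReal hr.le, ← ENNReal.rpow_mul,
    one_div_mul_cancel hr.ne', ENNReal.rpow_one]

theorem Lp_coeFn_sum_smul [Fact (1 ≤ ENNReal.ofReal r)] {n : ℕ} (c : Fin n → ℂ)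
    (y : Fin n → Lp ℂ (ENNReal.ofReal r) μ) :
    ⇑(∑ i, c i • y i) =ᵐ[μ] fun t => ∑ i, c i • y i t := by
  have h : ∀ᵐ t ∂μ, ∀ i, (c i • y i : Lp ℂ (ENNReal.ofReal r) μ) t = c i • y i t :=
    ae_all_iff.2 fun i => Lp.coeFn_smul (c i) (y i)
  filter_upwards [Lp.coeFn_finsetSum Finset.univ fun i => c i • y i, h] with t h1 h2
  rw [h1, Finset.sum_apply]
  exact Finset.sum_congr rfl fun i _ => h2 i

theorem Lp_sum_sign_enorm_rpow [Fact (1 ≤ ENNReal.ofReal r)] (hr : 0 < r) {n : ℕ}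
    (y : Fin n → Lp ℂ (ENNReal.ofReal r) μ) :
    ∑ ε : Fin n → ℤˣ, ‖∑ i, signC (ε i) • y i‖ₑ ^ r
      = ∫⁻ t, ∑ ε : Fin n → ℤˣ, ‖∑ i, signC (ε i) • y i t‖ₑ ^ r ∂μ := by
  have hm : ∀ i, AEMeasurable (fun t => y i t) μ := fun i => (Lp.aestronglyMeasurable _).aemeasurable
  rw [lintegral_finsetSum' _ fun ε _ => by fun_prop]
  refine Finset.sum_congr rfl fun ε _ => ?_
  rw [Lp_enorm_rpow hr]
  refine lintegral_congr_ae ?_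
  filter_upwards [Lp_coeFn_sum_smul (fun i => signC (ε i)) y] with t ht
  rw [ht]

theorem hasRademacherType_Lp_of_le_two [Fact (1 ≤ ENNReal.ofReal r)] (hr : 1 ≤ r) (hr2 : r ≤ 2) :
    HasRademacherType (Lp ℂ (ENNReal.ofReal r) μ) r 1 := by
  intro n y
  have hr0 : 0 < r := by linarith
  have hm : ∀ i, AEMeasurable (fun t => y i t) μ := fun i => (Lp.aestronglyMeasurable _).aemeasurable
  have hB : 0 ≤ ∑ i, ‖y i‖ ^ r := Finset.sum_nonneg fun _ _ => by positivity
  refine sum_norm_le_of_sum_rpow_le (fun ε => norm_nonneg _) hr (by positivity) ?_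
  rw [one_mul, ← Real.rpow_mul hB, one_div_mul_cancel hr0.ne', Real.rpow_one,
    ← ENNReal.ofReal_le_ofReal_iff (by positivity), ← sum_enorm_rpow_eq_ofReal _ hr0,
    Lp_sum_sign_enorm_rpow hr0, ENNReal.ofReal_mul (by positivity), ← sum_enorm_rpow_eq_ofReal _ hr0,
    ENNReal.ofReal_natCast]
  simp only [Lp_enorm_rpow hr0]
  rw [← lintegral_finsetSum' _ fun i _ => by fun_prop,
    ← lintegral_const_mul'' _ (by fun_prop)]
  refine lintegral_mono fun t => ?_
  dsimp only
  rw [sum_enorm_rpow_eq_ofReal _ hr0, sum_enorm_rpow_eq_ofReal _ hr0, ← ENNReal.ofReal_natCast,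
    ← ENNReal.ofReal_mul (by positivity)]
  exact ENNReal.ofReal_le_ofReal (sum_sign_rpow_le_of_le_two hr0 hr2 _)

/-- Minkowski's inequality in `L^{r/2}` for the functions `|yᵢ|²`; this is where `r ≥ 2` is needed.
-/
theorem Lp_lintegral_sum_sq_le [Fact (1 ≤ ENNReal.ofReal r)] (hr2 : 2 ≤ r) {n : ℕ}
    (y : Fin n → Lp ℂ (ENNReal.ofReal r) μ) :
    ∫⁻ t, (∑ i, ‖y i t‖ₑ ^ (2 : ℝ)) ^ (r / 2) ∂μ ≤ (∑ i, ‖y i‖ₑ ^ (2 : ℝ)) ^ (r / 2) := by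
  have hr0 : 0 < r := by linarith
  have hr20 : 0 < r / 2 := by linarith
  have hm : ∀ i, AEMeasurable (fun t => y i t) μ := fun i => (Lp.aestronglyMeasurable _).aemeasurable
  have h := eLpNorm_sum_le (μ := μ) (p := ENNReal.ofReal (r / 2)) (s := Finset.univ)
    (f := fun (i : Fin n) (t : Ω) => ‖y i t‖ₑ ^ (2 : ℝ))
    (fun i _ => AEMeasurable.aestronglyMeasurable (by fun_prop))
    (by rw [← ENNReal.ofReal_one]; exact ENNReal.ofReal_le_ofReal (by linarith))
  have e : ∀ i, eLpNorm (fun t => ‖y i t‖ₑ ^ (2 : ℝ)) (ENNReal.ofReal (r / 2)) μ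
      = ‖y i‖ₑ ^ (2 : ℝ) := fun i => by
    rw [eLpNorm_eq_lintegral_rpow_enorm_toReal (by simpa using hr20)
      ENNReal.ofReal_ne_top, ENNReal.toReal_ofReal hr20.le]
    simp only [enorm_eq_self, ← ENNReal.rpow_mul]
    rw [mul_div_cancel₀ _ two_ne_zero, ← Lp_enorm_rpow hr0, ← ENNReal.rpow_mul]
    congr 1; field_simp
  simp only [e] at h
  rw [eLpNorm_eq_lintegral_rpow_enorm_toReal (by simpa using hr20)
      ENNReal.ofReal_ne_top, ENNReal.toReal_ofReal hr20.le] at h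
  simp only [enorm_eq_self, Finset.sum_apply] at h
  rwa [one_div, ENNReal.rpow_inv_le_iff hr20] at h

theorem exists_hasRademacherType_Lp_of_two_le [Fact (1 ≤ ENNReal.ofReal r)] (hr2 : 2 ≤ r) :
    ∃ T : ℝ, 0 < T ∧ HasRademacherType (Lp ℂ (ENNReal.ofReal r) μ) 2 T := by
  have hr0 : 0 < r := by linarith
  set B : ℝ := 2 ^ r * (r ^ r * (2 * Real.exp (1 / 2))) with hBdef
  have hB : 0 < B := by positivity
  refine ⟨B ^ (1 / r), by positivity, fun n y => ?_⟩
  have hS : 0 ≤ ∑ i, ‖y i‖ ^ (2 : ℝ) := Finset.sum_nonneg fun _ _ => by positivity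
  have hm : ∀ i, AEMeasurable (fun t => y i t) μ := fun i => (Lp.aestronglyMeasurable _).aemeasurable
  refine sum_norm_le_of_sum_rpow_le (fun ε => norm_nonneg _) (by linarith : 1 ≤ r)
    (by positivity) ?_
  rw [Real.mul_rpow (by positivity) (by positivity), ← Real.rpow_mul hB.le,
    one_div_mul_cancel hr0.ne', Real.rpow_one, ← Real.rpow_mul hS, one_div_mul_eq_div,
    ← ENNReal.ofReal_le_ofReal_iff (by positivity), ← sum_enorm_rpow_eq_ofReal _ hr0,
    Lp_sum_sign_enorm_rpow hr0, ENNReal.ofReal_mul (by positivity),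
    ENNReal.ofReal_mul hB.le, ← ENNReal.ofReal_rpow_of_nonneg hS (by positivity),
    ← sum_enorm_rpow_eq_ofReal _ two_pos, ← mul_assoc]
  refine le_trans ?_ (mul_le_mul_right (Lp_lintegral_sum_sq_le hr2 y) _)
  rw [← lintegral_const_mul'' _ (by fun_prop)]
  refine lintegral_mono fun t => ?_
  dsimp only
  rw [sum_enorm_rpow_eq_ofReal _ hr0, sum_enorm_rpow_eq_ofReal _ two_pos,
    ENNReal.ofReal_rpow_of_nonneg (Finset.sum_nonneg fun _ _ => by positivity) (by positivity),
    mul_assoc, ← ENNReal.ofReal_mul hB.le, ← ENNReal.ofReal_mul (by positivity)]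
  exact ENNReal.ofReal_le_ofReal (sum_sign_rpow_le (by linarith) _)

end Lr

/-! ### Bounds for the rate of growth -/

section General

variable {E : Type*} [NormedAddCommGroup E] [NormedSpace ℂ E]

theorem pqGrowth_le_ofReal {p q C : ℝ} (hq : 0 < q) {n : ℕ}
    (h : ∀ (x : Fin n → E) (f : Fin n → StrongDual ℂ E), (∀ i, ‖x i‖ ≤ 1) →
      weakSummingNorm p f ≤ 1 → (∑ i, ‖f i (x i)‖ ^ q) ^ (1 / q) ≤ C) :
    pqGrowth E p q n ≤ ENNReal.ofReal C := by
  refine iSup₂_le fun x hx => iSup₂_le fun f hf => ?_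
  rw [rpow_sum_enorm_eq_ofReal _ hq]
  exact ENNReal.ofReal_le_ofReal (h x f hx hf)

theorem ofReal_le_pqGrowth {p q : ℝ} (hq : 0 < q) {n : ℕ} {x : Fin n → E}
    {f : Fin n → StrongDual ℂ E} (hx : ∀ i, ‖x i‖ ≤ 1) (hf : weakSummingNorm p f ≤ 1) :
    ENNReal.ofReal ((∑ i, ‖f i (x i)‖ ^ q) ^ (1 / q)) ≤ pqGrowth E p q n := by
  rw [← rpow_sum_enorm_eq_ofReal _ hq]
  refine le_trans ?_ (le_iSup₂ (f := fun (x : Fin n → E) (_ : ∀ i, ‖x i‖ ≤ 1) =>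
    pqMultiNorm p q x) x hx)
  exact le_iSup₂ (f := fun (f : Fin n → StrongDual ℂ E) (_ : weakSummingNorm p f ≤ 1) =>
    (∑ i, ‖f i (x i)‖ₑ ^ q) ^ (1 / q)) f hf

theorem ofReal_natCast_rpow {n : ℕ} (hn : 1 ≤ n) (a : ℝ) :
    ENNReal.ofReal ((n : ℝ) ^ a) = (n : ℝ≥0∞) ^ a := by
  rw [← ENNReal.ofReal_rpow_of_pos (by exact_mod_cast hn), ENNReal.ofReal_natCast]

theorem pqGrowth_le_rpow {p q : ℝ} (hp : 0 < p) (hq : 0 < q) {n : ℕ} (hn : 1 ≤ n) :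
    pqGrowth E p q n ≤ (n : ℝ≥0∞) ^ (1 / q) := by
  rw [← ofReal_natCast_rpow hn]
  refine pqGrowth_le_ofReal hq fun x f hx hf => ?_
  refine Real.rpow_le_rpow (Finset.sum_nonneg fun _ _ => by positivity) ?_ (by positivity)
  have h : ∀ i, ‖f i (x i)‖ ^ q ≤ 1 := fun i => by
    have h1 : ‖f i (x i)‖ ^ p ≤ 1 :=
      (Finset.single_le_sum (f := fun j => ‖f j (x i)‖ ^ p) (fun j _ => by positivity)
        (Finset.mem_univ i)).trans (sum_apply_rpow_le_one hp hf (hx i))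
    have h2 : ‖f i (x i)‖ ≤ 1 := by
      rw [← Real.rpow_le_rpow_iff (norm_nonneg _) zero_le_one hp, Real.one_rpow]; exact h1
    exact Real.rpow_le_one (norm_nonneg _) h2 hq.le
  calc ∑ i, ‖f i (x i)‖ ^ q ≤ ∑ _i : Fin n, (1 : ℝ) := Finset.sum_le_sum fun i _ => h i
    _ = n := by simp

theorem HasRademacherType.pqGrowth_le {τ T p q : ℝ} (hE : HasRademacherType E τ T) (hT : 0 ≤ T)
    (hτ : 0 < τ) (hp : 1 ≤ p) (hq : 0 < q) (hpq : 1 / τ ≤ 1 / p - 1 / q) (n : ℕ) :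
    pqGrowth E p q n ≤ ENNReal.ofReal T := by
  have hq1 : 0 < 1 / q := by positivity
  have hpos : 0 < 1 / p - 1 / τ := by linarith
  refine pqGrowth_le_ofReal hq fun x f hx hf => ?_
  refine (rpow_sum_rpow_anti (fun i => norm_nonneg _) (one_div_pos.2 hpos) ?_).trans
    (hE.rpow_sum_le hT hτ hp (one_div_pos.2 hpos) (one_div_one_div _) hf hx)
  rw [one_div_le hpos hq]; linarith

/-- Hölder from exponent `q` up to `1/(1/p - 1/τ)`, where the type bound applies. Strictness of `p <
τ` keeps that exponent finite. -/
theorem HasRademacherType.pqGrowth_le_rpow {τ T p q : ℝ} (hE : HasRademacherType E τ T)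
    (hT : 0 ≤ T) (hp : 1 ≤ p) (hpτ : p < τ) (hq : 0 < q) (hpq : 1 / p - 1 / q ≤ 1 / τ)
    {n : ℕ} (hn : 1 ≤ n) :
    pqGrowth E p q n ≤ ENNReal.ofReal T * (n : ℝ≥0∞) ^ (1 / τ - 1 / p + 1 / q) := by
  have hp0 : 0 < p := by linarith
  have hpos : 0 < 1 / p - 1 / τ := sub_pos.2 (one_div_lt_one_div_of_lt hp0 hpτ)
  rw [← ofReal_natCast_rpow hn, ← ENNReal.ofReal_mul hT]
  refine pqGrowth_le_ofReal hq fun x f hx hf => ?_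
  have h1 := rpow_sum_rpow_le_card (f := fun i => ‖f i (x i)‖) (fun i => norm_nonneg _) hq
    (b := 1 / (1 / p - 1 / τ)) (by rw [le_one_div hq hpos]; linarith)
  refine h1.trans ?_
  rw [one_div_one_div, Fintype.card_fin, mul_comm]
  have e : 1 / q - (1 / p - 1 / τ) = 1 / τ - 1 / p + 1 / q := by ring
  rw [e]
  refine mul_le_mul_of_nonneg_right ?_ (by positivity)
  have h2 := hE.rpow_sum_le hT (hp0.trans hpτ) hp (one_div_pos.2 hpos) (one_div_one_div _) hf hx
  rwa [one_div_one_div] at h2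

theorem one_le_pqGrowth [Nontrivial E] {p q : ℝ} (hp : 0 < p) (hq : 0 < q) {n : ℕ} (hn : 1 ≤ n) :
    1 ≤ pqGrowth E p q n := by
  obtain ⟨x₀, hx₀⟩ := exists_ne (0 : E)
  obtain ⟨g, hg1, hgx⟩ := exists_dual_vector ℂ x₀ (norm_ne_zero_iff.2 hx₀)
  set x : E := ((‖x₀‖ : ℂ)⁻¹) • x₀ with hxdef
  have hx0 : (‖x₀‖ : ℂ) ≠ 0 := by exact_mod_cast norm_ne_zero_iff.2 hx₀
  have hx : ‖x‖ = 1 := by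
    simp [hxdef, norm_smul, inv_mul_cancel₀ (norm_ne_zero_iff.2 hx₀)]
  have hgx' : g x = 1 := by
    rw [hxdef, map_smul, hgx, smul_eq_mul]; exact inv_mul_cancel₀ hx0
  let i₀ : Fin n := ⟨0, hn⟩
  -- The tuple with one norming functional and zeros elsewhere already gives the value one.
  have hw : weakSummingNorm p (Pi.single i₀ g : Fin n → StrongDual ℂ E) ≤ 1 := by
    rw [weakSummingNorm_le_one_iff hp]
    intro F hF
    rw [Finset.sum_eq_single i₀]
    · rw [Pi.single_eq_same]
      exact Real.rpow_le_one (norm_nonneg _)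
        ((F.le_of_opNorm_le hF g).trans (by rw [hg1, one_mul])) hp.le
    · intro i _ hi
      rw [Pi.single_eq_of_ne hi, map_zero, norm_zero, Real.zero_rpow hp.ne']
    · simp
  refine le_trans ?_ (ofReal_le_pqGrowth hq (x := fun _ => x) (fun _ => hx.le) hw)
  rw [ENNReal.one_le_ofReal]
  refine Real.one_le_rpow ?_ (by positivity)
  refine le_trans ?_ (Finset.single_le_sum (f := fun i =>
    ‖(Pi.single i₀ g : Fin n → StrongDual ℂ E) i x‖ ^ q) (fun _ _ => by positivity)
    (Finset.mem_univ i₀))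
  simp [hgx']

/-! ### Lower bounds from weakly summing systems -/

theorem weakSummingNorm_le_one_of_norm_sum_smul_le {τ σ : ℝ} (hτσ : τ.HolderConjugate σ) {n : ℕ}
    {x : Fin n → E} (h : ∀ c : Fin n → ℂ, ‖∑ i, c i • x i‖ ≤ (∑ i, ‖c i‖ ^ σ) ^ (1 / σ)) :
    weakSummingNorm τ x ≤ 1 := by
  have hτ := hτσ.pos
  have hσ := hτσ.symm.pos
  rw [weakSummingNorm_le_one_iff hτ]
  intro F hF
  choose u hu1 hu2 using fun i => exists_phase (F (x i))
  set m : Fin n → ℝ := fun i => ‖F (x i)‖ with hm_def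
  have hm : ∀ i, 0 ≤ m i := fun i => norm_nonneg _
  set S := ∑ i, m i ^ τ with hS
  change S ≤ 1
  have hS0 : 0 ≤ S := Finset.sum_nonneg fun i _ => Real.rpow_nonneg (hm i) _
  rcases hS0.eq_or_lt with h0 | hpos
  · rw [← h0]; exact zero_le_one
  -- The coefficients attain equality in Hölder: `(τ - 1)σ = τ`, so their `ℓ^σ` norm is at most
  -- `S^{1/σ}` while `F` takes the value `S`.
  have hsum : F (∑ i, (((m i ^ (τ - 1) : ℝ) : ℂ) * u i) • x i) = (S : ℂ) := by
    rw [map_sum, hS, Complex.ofReal_sum]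
    refine Finset.sum_congr rfl fun i _ => ?_
    rw [map_smul, smul_eq_mul, mul_assoc, hu2, ← Complex.ofReal_mul]
    congr 1
    rcases (hm i).eq_or_lt with h0 | hpos
    · change _ * m i = _
      rw [← h0, Real.zero_rpow hτ.ne', mul_zero]
    · change m i ^ (τ - 1) * m i = _
      rw [← Real.rpow_add_one hpos.ne', sub_add_cancel]
  have hle : S ≤ S ^ (1 / σ) := by
    calc S = ‖F (∑ i, (((m i ^ (τ - 1) : ℝ) : ℂ) * u i) • x i)‖ := by
          rw [hsum, Complex.norm_real, Real.norm_eq_abs, abs_of_nonneg hS0]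
      _ ≤ 1 * ‖∑ i, (((m i ^ (τ - 1) : ℝ) : ℂ) * u i) • x i‖ := F.le_of_opNorm_le hF _
      _ ≤ (∑ i, ‖((m i ^ (τ - 1) : ℝ) : ℂ) * u i‖ ^ σ) ^ (1 / σ) := by rw [one_mul]; exact h _
      _ ≤ S ^ (1 / σ) := by
          refine Real.rpow_le_rpow (Finset.sum_nonneg fun _ _ => by positivity)
            (Finset.sum_le_sum fun i _ => ?_) (by positivity)
          have h1 : ‖((m i ^ (τ - 1) : ℝ) : ℂ) * u i‖ ≤ m i ^ (τ - 1) := by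
            rw [norm_mul, Complex.norm_real, Real.norm_eq_abs,
              abs_of_nonneg (Real.rpow_nonneg (hm i) _)]
            exact mul_le_of_le_one_right (Real.rpow_nonneg (hm i) _) (hu1 i)
          refine (Real.rpow_le_rpow (norm_nonneg _) h1 hσ.le).trans (le_of_eq ?_)
          rw [← Real.rpow_mul (hm i), hτσ.sub_one_mul_conj]
  have hadd : 1 / τ + 1 / σ = 1 := by
    simpa only [one_div] using hτσ.inv_add_inv_eq_one
  have h2 : S ^ (1 / τ) ≤ 1 := by
    have h3 : S ^ (1 / τ) * S ^ (1 / σ) ≤ 1 * S ^ (1 / σ) := by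
      rw [← Real.rpow_add hpos, hadd, Real.rpow_one, one_mul]; exact hle
    exact le_of_mul_le_mul_right h3 (by positivity)
  rw [← Real.rpow_le_rpow_iff hS0 zero_le_one (show 0 < 1 / τ by positivity), Real.one_rpow]
  exact h2

theorem ofReal_le_of_forall_lt_one {A : ℝ} {X : ℝ≥0∞}
    (h : ∀ δ : ℝ, 0 < δ → δ < 1 → ENNReal.ofReal (δ * A) ≤ X) : ENNReal.ofReal A ≤ X := by
  refine ENNReal.le_of_forall_nnreal_lt fun y hy => ?_
  have hyA : (y : ℝ) < A := by
    rwa [ENNReal.lt_ofReal_iff_toReal_lt ENNReal.coe_ne_top, ENNReal.coe_toReal] at hy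
  have hy0 : (0 : ℝ) ≤ y := y.2
  have hA0 : 0 < A := hy0.trans_lt hyA
  -- This `δ` makes `δ * A` the midpoint of `y` and `A`.
  refine le_trans ?_ (h ((y + A) / (2 * A)) (by positivity) (by rw [div_lt_one (by positivity)]; linarith))
  have e : (y + A) / (2 * A) * A = (y + A) / 2 := by field_simp
  rw [e, ← ENNReal.ofReal_coe_nnreal]
  exact ENNReal.ofReal_le_ofReal (by linarith)

theorem rpow_le_pqGrowth_of_forall {p q κ : ℝ} (hq : 0 < q) (hκ : 0 ≤ κ) {n : ℕ}
    (h : ∀ δ : ℝ, 0 < δ → δ < 1 → ∃ (f : Fin n → StrongDual ℂ E) (x : Fin n → E),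
      weakSummingNorm p f ≤ 1 ∧ (∀ i, ‖x i‖ ≤ 1) ∧ ∀ i, δ * κ ≤ ‖f i (x i)‖) :
    ENNReal.ofReal (κ * (n : ℝ) ^ (1 / q)) ≤ pqGrowth E p q n := by
  refine ofReal_le_of_forall_lt_one fun δ hδ0 hδ1 => ?_
  obtain ⟨f, x, hf, hx, hfx⟩ := h δ hδ0 hδ1
  refine le_trans (ENNReal.ofReal_le_ofReal ?_) (ofReal_le_pqGrowth hq hx hf)
  have hδκ : 0 ≤ δ * κ := by positivity
  calc δ * (κ * (n : ℝ) ^ (1 / q)) = (∑ _i : Fin n, (δ * κ) ^ q) ^ (1 / q) := by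
        rw [Finset.sum_const, Finset.card_univ, Fintype.card_fin, nsmul_eq_mul,
          Real.mul_rpow (by positivity) (by positivity), ← Real.rpow_mul hδκ,
          mul_one_div_cancel hq.ne', Real.rpow_one]
        ring
    _ ≤ _ := by
        refine Real.rpow_le_rpow (by positivity) (Finset.sum_le_sum fun i _ => ?_) (by positivity)
        exact Real.rpow_le_rpow hδκ (hfx i) hq.le

/-- For each `n` there are `n` functionals on `E`, of norm nearly one, whose weak `τ`-summing norm
is at most one. -/
def HasWeakSummingSystems (E : Type*) [NormedAddCommGroup E] [NormedSpace ℂ E] (τ : ℝ) : Prop :=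
  ∀ (n : ℕ) (δ : ℝ), 0 < δ → δ < 1 → ∃ (f : Fin n → StrongDual ℂ E) (x : Fin n → E),
    weakSummingNorm τ f ≤ 1 ∧ (∀ i, ‖x i‖ ≤ 1) ∧ ∀ i, δ ≤ ‖f i (x i)‖

theorem HasWeakSummingSystems.rpow_le_pqGrowth {τ p q : ℝ} (hE : HasWeakSummingSystems E τ)
    (hτ : 0 < τ) (hτp : τ ≤ p) (hq : 0 < q) {n : ℕ} (hn : 1 ≤ n) :
    (n : ℝ≥0∞) ^ (1 / q) ≤ pqGrowth E p q n := by
  rw [← ofReal_natCast_rpow hn, ← one_mul ((n : ℝ) ^ (1 / q))]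
  refine rpow_le_pqGrowth_of_forall hq zero_le_one fun δ hδ0 hδ1 => ?_
  obtain ⟨f, x, hf, hx, hfx⟩ := hE n δ hδ0 hδ1
  refine ⟨f, x, ?_, hx, by simpa using hfx⟩
  have hp : 0 < p := hτ.trans_le hτp
  rw [weakSummingNorm_le_one_iff hτ] at hf
  rw [weakSummingNorm_le_one_iff hp]
  intro F hF
  have h1 := rpow_sum_rpow_anti (f := fun i => ‖F (f i)‖) (fun i => norm_nonneg _) hτ hτp
  have h2 : (∑ i, ‖F (f i)‖ ^ τ) ^ (1 / τ) ≤ 1 :=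
    Real.rpow_le_one (Finset.sum_nonneg fun _ _ => by positivity) (hf F hF) (by positivity)
  rw [← Real.rpow_le_rpow_iff (Finset.sum_nonneg fun _ _ => by positivity) zero_le_one
    (show 0 < 1 / p by positivity), Real.one_rpow]
  exact h1.trans h2

theorem HasWeakSummingSystems.rpow_sub_le_pqGrowth {τ p q : ℝ} (hE : HasWeakSummingSystems E τ)
    (hp : 0 < p) (hpτ : p ≤ τ) (hq : 0 < q) {n : ℕ} (hn : 1 ≤ n) :
    (n : ℝ≥0∞) ^ (1 / τ - 1 / p + 1 / q) ≤ pqGrowth E p q n := by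
  have hn0 : (0 : ℝ) < n := by exact_mod_cast hn
  have hτ : 0 < τ := hp.trans_le hpτ
  rw [← ofReal_natCast_rpow hn, Real.rpow_add hn0]
  -- The scaling exactly offsets the factor `n^{1/p - 1/τ}` that Hölder costs in passing from `ℓ^τ`
  -- to `ℓ^p`.
  set κ := (n : ℝ) ^ (1 / τ - 1 / p) with hκdef
  have hκ : 0 ≤ κ := by positivity
  refine rpow_le_pqGrowth_of_forall hq hκ fun δ hδ0 hδ1 => ?_
  obtain ⟨f, x, hf, hx, hfx⟩ := hE n δ hδ0 hδ1
  refine ⟨fun i => (κ : ℂ) • f i, x, ?_, hx, fun i => ?_⟩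
  · rw [weakSummingNorm_le_one_iff hτ] at hf
    rw [weakSummingNorm_le_one_iff hp]
    intro F hF
    have h1 := rpow_sum_rpow_le_card (f := fun i => ‖F (f i)‖) (fun i => norm_nonneg _) hp hpτ
    have h2 : (∑ i, ‖F (f i)‖ ^ τ) ^ (1 / τ) ≤ 1 :=
      Real.rpow_le_one (Finset.sum_nonneg fun _ _ => by positivity) (hf F hF) (by positivity)
    have hA : 0 ≤ ∑ i, ‖F (f i)‖ ^ p := Finset.sum_nonneg fun _ _ => by positivity
    have e : ∑ i, ‖F ((κ : ℂ) • f i)‖ ^ p = κ ^ p * ∑ i, ‖F (f i)‖ ^ p := by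
      rw [Finset.mul_sum]
      refine Finset.sum_congr rfl fun i _ => ?_
      rw [map_smul, norm_smul, Complex.norm_real, Real.norm_eq_abs, abs_of_nonneg hκ,
        Real.mul_rpow hκ (norm_nonneg _)]
    rw [e, ← Real.rpow_le_rpow_iff (by positivity) zero_le_one
      (show 0 < 1 / p by positivity), Real.one_rpow, Real.mul_rpow (by positivity) hA,
      ← Real.rpow_mul hκ, mul_one_div_cancel hp.ne', Real.rpow_one]
    calc κ * (∑ i, ‖F (f i)‖ ^ p) ^ (1 / p)
        ≤ κ * ((n : ℝ) ^ (1 / p - 1 / τ) * 1) := by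
          refine mul_le_mul_of_nonneg_left (h1.trans ?_) hκ
          rw [Fintype.card_fin]
          exact mul_le_mul_of_nonneg_left h2 (by positivity)
      _ = 1 := by
          rw [mul_one, hκdef, ← Real.rpow_add hn0]
          simp
  · rw [_root_.smul_apply, norm_smul, Complex.norm_real, Real.norm_eq_abs, abs_of_nonneg hκ,
      mul_comm]
    exact mul_le_mul_of_nonneg_left (hfx i) hκ

end General

/-! ### Copies of `ℓ^r` in `L^r` -/

section Lr

variable {Ω : Type*} [MeasurableSpace Ω] {μ : Measure Ω}

/-- A pairwise disjoint family of measurable sets of positive finite measure. -/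
structure IsDisjointFamily (μ : Measure Ω) {N : ℕ} (A : Fin N → Set Ω) : Prop where
  meas : ∀ k, MeasurableSet (A k)
  pos : ∀ k, μ (A k) ≠ 0
  fin : ∀ k, μ (A k) ≠ ∞
  disj : ∀ j k, j ≠ k → Disjoint (A j) (A k)

theorem IsDisjointFamily.cons {N : ℕ} {A : Fin N → Set Ω} (hA : IsDisjointFamily μ A) {D : Set Ω}
    (hD : MeasurableSet D) (hD0 : μ D ≠ 0) (hDf : μ D ≠ ∞) (hDA : ∀ k, Disjoint D (A k)) :
    IsDisjointFamily μ (Fin.cons D A : Fin (N + 1) → Set Ω) where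
  meas k := by refine Fin.cases ?_ (fun i => ?_) k <;> simp [hD, hA.meas]
  pos k := by refine Fin.cases ?_ (fun i => ?_) k <;> simp [hD0, hA.pos]
  fin k := by refine Fin.cases ?_ (fun i => ?_) k <;> simp [hDf, hA.fin]
  disj j k := by
    refine Fin.cases ?_ (fun i => ?_) j <;> refine Fin.cases ?_ (fun i' => ?_) k
    · simp
    · simp [hDA]
    · simp [(hDA _).symm]
    · intro h
      simpa using hA.disj i i' (fun e => h (by rw [e]))

theorem IsDisjointFamily.update {N : ℕ} {A : Fin N → Set Ω} (hA : IsDisjointFamily μ A) {k : Fin N}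
    {B : Set Ω} (hB : MeasurableSet B) (hB0 : μ B ≠ 0) (hBA : B ⊆ A k) :
    IsDisjointFamily μ (Function.update A k B) where
  meas j := by by_cases h : j = k <;> simp [h, hB, hA.meas]
  pos j := by by_cases h : j = k <;> simp [h, hB0, hA.pos]
  fin j := by
    by_cases h : j = k
    · subst h; simpa using ne_top_of_le_ne_top (hA.fin _) (measure_mono hBA)
    · simp [h, hA.fin]
  disj i j hij := by
    by_cases h : i = k
    · subst h
      simpa [Function.update_of_ne hij.symm] using (hA.disj i j hij).mono_left hBA
    · by_cases h' : j = k
      · subst h'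
        simpa [Function.update_of_ne hij] using (hA.disj i j hij).mono_right hBA
      · simpa [h, h'] using hA.disj i j hij

/-- Here `h1` says that the `A k` are atoms and `h2` that they exhaust every set of finite measure.
So `C` is, up to a null set, the union of those atoms that it meets in positive measure. -/
theorem IsDisjointFamily.sum_indicator_ae {N : ℕ} {A : Fin N → Set Ω} (hA : IsDisjointFamily μ A)
    (h1 : ∀ k B, MeasurableSet B → B ⊆ A k → μ B = 0 ∨ μ (A k \ B) = 0)
    (h2 : ∀ C, MeasurableSet C → μ C ≠ ∞ → μ (C \ ⋃ k, A k) = 0)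
    {C : Set Ω} (hC : MeasurableSet C) (hCf : μ C ≠ ∞) :
    ∃ K : Finset (Fin N), ∀ c : ℂ,
      (C.indicator fun _ => c) =ᵐ[μ] fun t => ∑ k ∈ K, c * (A k).indicator (fun _ => 1) t := by
  classical
  refine ⟨Finset.univ.filter fun k => μ (C ∩ A k) ≠ 0, fun c => ?_⟩
  have a1 : ∀ᵐ t ∂μ, t ∉ C \ ⋃ k, A k := measure_eq_zero_iff_ae_notMem.1 (h2 C hC hCf)
  have a2 : ∀ᵐ t ∂μ, ∀ k, μ (C ∩ A k) ≠ 0 → t ∉ A k \ C := by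
    refine ae_all_iff.2 fun k => ?_
    by_cases h : μ (C ∩ A k) = 0
    · simp [h]
    · have h3 := (h1 k (C ∩ A k) (hC.inter (hA.meas k)) Set.inter_subset_right).resolve_left h
      rw [Set.sdiff_inter_self_eq_sdiff] at h3
      filter_upwards [measure_eq_zero_iff_ae_notMem.1 h3] with t ht _ using ht
  have a3 : ∀ᵐ t ∂μ, ∀ k, μ (C ∩ A k) = 0 → t ∉ C ∩ A k := by
    refine ae_all_iff.2 fun k => ?_
    by_cases h : μ (C ∩ A k) = 0
    · filter_upwards [measure_eq_zero_iff_ae_notMem.1 h] with t ht _ using ht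
    · simp [h]
  filter_upwards [a1, a2, a3] with t t1 t2 t3
  by_cases ht : t ∈ C
  · have : t ∈ ⋃ k, A k := by by_contra hn; exact t1 ⟨ht, hn⟩
    obtain ⟨k, hk⟩ := Set.mem_iUnion.1 this
    rw [Set.indicator_of_mem ht, Finset.sum_eq_single k]
    · simp [hk]
    · intro j _ hjk
      have : t ∉ A j := fun hj => (Set.disjoint_left.1 (hA.disj j k hjk)) hj hk
      simp [this]
    · intro hk'
      have h0 : μ (C ∩ A k) = 0 := by simpa using hk'
      exact absurd ⟨ht, hk⟩ (t3 k h0)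
  · rw [Set.indicator_of_notMem ht]
    symm
    refine Finset.sum_eq_zero fun k hk => ?_
    have hk' : μ (C ∩ A k) ≠ 0 := by simpa using hk
    have : t ∉ A k := fun h => t2 k hk' ⟨h, ht⟩
    simp [this]

variable {r : ℝ} [Fact (1 ≤ ENNReal.ofReal r)]

theorem IsDisjointFamily.finiteDimensional_Lp {N : ℕ} {A : Fin N → Set Ω}
    (hA : IsDisjointFamily μ A)
    (h1 : ∀ k B, MeasurableSet B → B ⊆ A k → μ B = 0 ∨ μ (A k \ B) = 0)
    (h2 : ∀ C, MeasurableSet C → μ C ≠ ∞ → μ (C \ ⋃ k, A k) = 0) :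
    FiniteDimensional ℂ (Lp ℂ (ENNReal.ofReal r) μ) := by
  set v : Fin N → Lp ℂ (ENNReal.ofReal r) μ := fun k =>
    indicatorConstLp _ (hA.meas k) (hA.fin k) 1 with hv
  set V := Submodule.span ℂ (Set.range v) with hV
  have hVfin : FiniteDimensional ℂ V := FiniteDimensional.span_of_finite ℂ (Set.finite_range v)
  have hmem : ∀ f : Lp ℂ (ENNReal.ofReal r) μ, f ∈ V := by
    refine Lp.induction ENNReal.ofReal_ne_top (fun f => f ∈ V) ?_ ?_ ?_
    · intro c s hs hμs
      rw [Lp.simpleFunc.coe_indicatorConst]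
      obtain ⟨K, hK⟩ := hA.sum_indicator_ae h1 h2 hs hμs.ne
      have e : indicatorConstLp (ENNReal.ofReal r) hs hμs.ne c = ∑ k ∈ K, c • v k := by
        refine Lp.ext ?_
        have hvk : ∀ᵐ t ∂μ, ∀ k, (c • v k : Lp ℂ (ENNReal.ofReal r) μ) t
            = c * (A k).indicator (fun _ => 1) t := ae_all_iff.2 fun k => by
          filter_upwards [Lp.coeFn_smul c (v k),
            indicatorConstLp_coeFn (p := ENNReal.ofReal r) (hs := hA.meas k) (hμs := hA.fin k)
              (c := (1 : ℂ))] with t h3 h4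
          rw [h3, Pi.smul_apply, hv, h4, smul_eq_mul]
        filter_upwards [indicatorConstLp_coeFn (p := ENNReal.ofReal r) (hs := hs)
          (hμs := hμs.ne) (c := c), hK c, Lp.coeFn_finsetSum K fun k => c • v k, hvk] with t t1 t2 t3 t4
        rw [t1, t2, t3, Finset.sum_apply]
        exact Finset.sum_congr rfl fun k _ => (t4 k).symm
      rw [e]
      exact Submodule.sum_mem _ fun k _ => V.smul_mem c (Submodule.subset_span ⟨k, rfl⟩)
    · intro f g hf hg _ hf' hg'
      exact V.add_mem hf' hg'
    -- A finite-dimensional span is closed, so containing the indicators forces it to be everything.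
    · exact V.closed_of_finiteDimensional
  have htop : V = ⊤ := Submodule.eq_top_iff'.2 hmem
  rw [htop] at hVfin
  exact Module.finite_def.2 (Module.Finite.iff_fg.1 hVfin)

/-- A family of size `N` can be enlarged either by splitting a member or by adding a set outside the
union. If neither is possible, the space is spanned by finitely many atoms. -/
theorem exists_isDisjointFamily (hdim : ¬ FiniteDimensional ℂ (Lp ℂ (ENNReal.ofReal r) μ)) (N : ℕ) :
    ∃ A : Fin N → Set Ω, IsDisjointFamily μ A := by
  induction N with
  | zero => exact ⟨Fin.elim0, ⟨fun k => k.elim0, fun k => k.elim0, fun k => k.elim0,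
      fun k => k.elim0⟩⟩
  | succ N ih =>
    obtain ⟨A, hA⟩ := ih
    by_cases h1 : ∀ k B, MeasurableSet B → B ⊆ A k → μ B = 0 ∨ μ (A k \ B) = 0
    · by_cases h2 : ∀ C, MeasurableSet C → μ C ≠ ∞ → μ (C \ ⋃ k, A k) = 0
      · exact absurd (hA.finiteDimensional_Lp h1 h2) hdim
      · push Not at h2
        obtain ⟨C, hC, hCf, hC0⟩ := h2
        refine ⟨_, hA.cons (hC.diff (MeasurableSet.iUnion hA.meas)) hC0
          (ne_top_of_le_ne_top hCf (measure_mono Set.sdiff_subset)) fun k => ?_⟩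
        exact Set.disjoint_sdiff_left.mono_right (Set.subset_iUnion A k)
    · push Not at h1
      obtain ⟨k, B, hB, hBA, hB0, hB1⟩ := h1
      refine ⟨_, (hA.update hB hB0 hBA).cons ((hA.meas k).diff hB) hB1
        (ne_top_of_le_ne_top (hA.fin k) (measure_mono Set.sdiff_subset)) fun j => ?_⟩
      by_cases h : j = k
      · subst h; simpa using Set.disjoint_sdiff_left
      · simpa [h] using (hA.disj k j (Ne.symm h)).mono_left Set.sdiff_subset

end Lr

/-! ### Biorthogonal systems spanning `ℓ^r` in `L^r` -/

section Lr

variable {Ω : Type*} [MeasurableSpace Ω] {μ : Measure Ω} {r : ℝ}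

theorem Lp_enorm_setIntegral_rpow_le (hr : 1 ≤ r) {A : Set Ω} (f : Lp ℂ (ENNReal.ofReal r) μ) :
    ‖∫ t in A, f t ∂μ‖ₑ ≤ (∫⁻ t in A, ‖f t‖ₑ ^ r ∂μ) ^ (1 / r) * μ A ^ (1 - 1 / r) := by
  have hr0 : 0 < r := by linarith
  have h := eLpNorm_le_eLpNorm_mul_rpow_measure_univ (μ := μ.restrict A) (p := 1)
    (q := ENNReal.ofReal r) (by rw [← ENNReal.ofReal_one]; exact ENNReal.ofReal_le_ofReal hr)
    (Lp.aestronglyMeasurable f).restrict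
  rw [eLpNorm_one_eq_lintegral_enorm, eLpNorm_eq_lintegral_rpow_enorm_toReal (by simpa using hr0)
    ENNReal.ofReal_ne_top, ENNReal.toReal_ofReal hr0.le] at h
  simpa using (enorm_integral_le_lintegral_enorm _).trans h

theorem enorm_sum_rpow_le_of_unique {ι : Type*} [Fintype ι] {w : ι → ℂ} (hr : 0 < r)
    (h : ∀ j k, j ≠ k → w j = 0 ∨ w k = 0) : ‖∑ k, w k‖ₑ ^ r ≤ ∑ k, ‖w k‖ₑ ^ r := by
  by_cases h0 : ∀ k, w k = 0
  · simp [h0, hr]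
  · push Not at h0
    obtain ⟨k, hk⟩ := h0
    rw [Finset.sum_eq_single k (fun j _ hj => (h j k hj).resolve_right hk) (by simp)]
    exact Finset.single_le_sum (f := fun k => ‖w k‖ₑ ^ r) (fun _ _ => zero_le)
      (Finset.mem_univ k)

variable [Fact (1 ≤ ENNReal.ofReal r)]

/-- Integration over a set of finite measure, as a continuous functional on `L^r`. -/
theorem exists_setIntegral_functional (hr : 1 ≤ r) {A : Set Ω} (hA : μ A ≠ ∞) :
    ∃ e : StrongDual ℂ (Lp ℂ (ENNReal.ofReal r) μ), ∀ f, e f = ∫ t in A, f t ∂μ := by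
  have hr0 : 0 < r := by linarith
  have hint : ∀ f : Lp ℂ (ENNReal.ofReal r) μ, IntegrableOn (fun t => f t) A μ := fun f =>
    integrableOn_Lp_of_measure_ne_top f (Fact.out : 1 ≤ ENNReal.ofReal r) hA
  have hr1 : 0 ≤ 1 - 1 / r := by
    rw [sub_nonneg, div_le_one hr0]; exact hr
  let L : Lp ℂ (ENNReal.ofReal r) μ →ₗ[ℂ] ℂ :=
    { toFun := fun f => ∫ t in A, f t ∂μ
      map_add' := fun f g => by
        rw [← integral_add (hint f) (hint g)]
        exact integral_congr_ae (ae_restrict_of_ae (Lp.coeFn_add f g))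
      map_smul' := fun c f => by
        rw [RingHom.id_apply, ← integral_smul]
        exact integral_congr_ae (ae_restrict_of_ae (Lp.coeFn_smul c f)) }
  refine ⟨L.mkContinuous ((μ A ^ (1 - 1 / r)).toReal) fun f => ?_, fun f => rfl⟩
  have h := Lp_enorm_setIntegral_rpow_le hr (A := A) f
  have h2 : (∫⁻ t in A, ‖f t‖ₑ ^ r ∂μ) ^ (1 / r) ≤ ‖f‖ₑ := by
    rw [one_div, ENNReal.rpow_inv_le_iff hr0, Lp_enorm_rpow hr0]
    exact setLIntegral_le_lintegral _ _
  have h3 : ‖L f‖ₑ ≤ ‖f‖ₑ * μ A ^ (1 - 1 / r) := h.trans (mul_le_mul_left h2 _)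
  have hfin : μ A ^ (1 - 1 / r) ≠ ∞ := ENNReal.rpow_ne_top_of_nonneg hr1 hA
  have h4 := ENNReal.toReal_mono (ENNReal.mul_ne_top enorm_ne_top hfin) h3
  rw [ENNReal.toReal_mul, toReal_enorm, toReal_enorm, mul_comm] at h4
  exact h4

/-- Normalised indicators of disjoint sets and normalised integrals over them. The bound on the `e
k` is the dual form of an `ℓ^{r'}` upper estimate for their combinations, so no identification of
the dual of `L^r` is required. -/
theorem exists_lr_biorthogonal (hr : 1 ≤ r)
    (hdim : ¬ FiniteDimensional ℂ (Lp ℂ (ENNReal.ofReal r) μ)) (N : ℕ) :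
    ∃ (e : Fin N → StrongDual ℂ (Lp ℂ (ENNReal.ofReal r) μ))
      (v : Fin N → Lp ℂ (ENNReal.ofReal r) μ),
      (∀ f, ∑ k, ‖e k f‖ ^ r ≤ ‖f‖ ^ r) ∧
      (∀ d : Fin N → ℂ, ‖∑ k, d k • v k‖ ^ r ≤ ∑ k, ‖d k‖ ^ r) ∧
      ∀ j k, e j (v k) = if j = k then 1 else 0 := by
  have hr0 : 0 < r := by linarith
  obtain ⟨A, hA⟩ := exists_isDisjointFamily hdim N
  choose e₀ he₀ using fun k => exists_setIntegral_functional (r := r) hr (hA.fin k)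
  have hm : ∀ k, 0 < μ.real (A k) := fun k =>
    ENNReal.toReal_pos (hA.pos k) (hA.fin k)
  set v₀ : Fin N → Lp ℂ (ENNReal.ofReal r) μ := fun k =>
    indicatorConstLp _ (hA.meas k) (hA.fin k) 1 with hv₀
  have hv₀n : ∀ k, ‖v₀ k‖ = μ.real (A k) ^ (1 / r) := fun k => by
    rw [hv₀, norm_indicatorConstLp (by simpa using hr0) ENNReal.ofReal_ne_top,
      ENNReal.toReal_ofReal hr0.le, norm_one, one_mul]
  have hv₀0 : ∀ᵐ t ∂μ, ∀ k, t ∉ A k → v₀ k t = 0 :=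
    ae_all_iff.2 fun k => indicatorConstLp_coeFn_notMem
  have hev : ∀ j k, e₀ j (v₀ k) = if j = k then (μ.real (A j) : ℂ) else 0 := fun j k => by
    rw [he₀, hv₀, setIntegral_indicatorConstLp (hA.meas j)]
    split_ifs with h
    · subst h; simp
    · rw [Set.disjoint_iff_inter_eq_empty.1 (hA.disj k j (Ne.symm h))]; simp
  have hvn : ∀ k, ‖((μ.real (A k) ^ (-(1 / r)) : ℝ) : ℂ) • v₀ k‖ = 1 := fun k => by
    rw [norm_smul, Complex.norm_real, Real.norm_eq_abs, abs_of_nonneg (by positivity), hv₀n,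
      ← Real.rpow_add (hm k)]
    simp
  -- The two weights multiply to `1 / μ(A k)`, cancelling the integral of the indicator; the first
  -- offsets the Hölder factor, the second normalises `v₀ k`.
  refine ⟨fun k => ((μ.real (A k) ^ (-(1 - 1 / r)) : ℝ) : ℂ) • e₀ k,
    fun k => ((μ.real (A k) ^ (-(1 / r)) : ℝ) : ℂ) • v₀ k, fun f => ?_, fun d => ?_, fun j k => ?_⟩
  · rw [← ENNReal.ofReal_le_ofReal_iff (by positivity), ← sum_enorm_rpow_eq_ofReal _ hr0,
      ← ENNReal.ofReal_rpow_of_nonneg (norm_nonneg _) hr0.le, ofReal_norm, Lp_enorm_rpow hr0]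
    have hk : ∀ k, ‖(((μ.real (A k) ^ (-(1 - 1 / r)) : ℝ) : ℂ) • e₀ k) f‖ₑ ^ r
        ≤ ∫⁻ t in A k, ‖f t‖ₑ ^ r ∂μ := fun k => by
      have h1 := Lp_enorm_setIntegral_rpow_le hr (A := A k) f
      have h2 : ‖((μ.real (A k) ^ (-(1 - 1 / r)) : ℝ) : ℂ)‖ₑ = μ (A k) ^ (-(1 - 1 / r)) := by
        rw [← ofReal_norm, Complex.norm_real, Real.norm_eq_abs, abs_of_nonneg (by positivity),
          ← ENNReal.ofReal_rpow_of_pos (hm k), ofReal_measureReal (hA.fin k)]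
      rw [_root_.smul_apply, he₀, enorm_smul, h2]
      calc (μ (A k) ^ (-(1 - 1 / r)) * ‖∫ t in A k, f t ∂μ‖ₑ) ^ r
          ≤ (μ (A k) ^ (-(1 - 1 / r)) * ((∫⁻ t in A k, ‖f t‖ₑ ^ r ∂μ) ^ (1 / r)
              * μ (A k) ^ (1 - 1 / r))) ^ r := by gcongr
        _ = ((∫⁻ t in A k, ‖f t‖ₑ ^ r ∂μ) ^ (1 / r)) ^ r := by
            congr 1
            rw [mul_left_comm, ← ENNReal.rpow_add _ _ (hA.pos k) (hA.fin k)]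
            simp
        _ = ∫⁻ t in A k, ‖f t‖ₑ ^ r ∂μ := by
            rw [← ENNReal.rpow_mul, one_div_mul_cancel hr0.ne', ENNReal.rpow_one]
    calc _ ≤ ∑ k, ∫⁻ t in A k, ‖f t‖ₑ ^ r ∂μ := Finset.sum_le_sum fun k _ => hk k
      _ = ∫⁻ t in ⋃ k, A k, ‖f t‖ₑ ^ r ∂μ := by
          rw [lintegral_iUnion hA.meas (fun j k h => hA.disj j k h), tsum_fintype]
      _ ≤ _ := setLIntegral_le_lintegral _ _
  · rw [← ENNReal.ofReal_le_ofReal_iff (Finset.sum_nonneg fun _ _ => by positivity),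
      ← sum_enorm_rpow_eq_ofReal _ hr0,
      ← ENNReal.ofReal_rpow_of_nonneg (norm_nonneg _) hr0.le, ofReal_norm, Lp_enorm_rpow hr0]
    set v : Fin N → Lp ℂ (ENNReal.ofReal r) μ :=
      fun k => ((μ.real (A k) ^ (-(1 / r)) : ℝ) : ℂ) • v₀ k with hv
    have hv0 : ∀ᵐ t ∂μ, ∀ k, t ∉ A k → v k t = 0 := by
      have h : ∀ᵐ t ∂μ, ∀ k, v k t = ((μ.real (A k) ^ (-(1 / r)) : ℝ) : ℂ) • v₀ k t :=
        ae_all_iff.2 fun k => Lp.coeFn_smul _ (v₀ k)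
      filter_upwards [h, hv₀0] with t h1 h2 k hk
      rw [h1, h2 k hk, smul_zero]
    have hmeas : ∀ k, AEMeasurable (fun t => v k t) μ := fun k =>
      (Lp.aestronglyMeasurable _).aemeasurable
    calc ∫⁻ t, ‖(∑ k, d k • v k : Lp ℂ (ENNReal.ofReal r) μ) t‖ₑ ^ r ∂μ
        ≤ ∫⁻ t, ∑ k, ‖d k‖ₑ ^ r * ‖v k t‖ₑ ^ r ∂μ := by
          refine lintegral_mono_ae ?_
          filter_upwards [Lp_coeFn_sum_smul d v, hv0] with t h1 h2
          rw [h1]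
          refine (enorm_sum_rpow_le_of_unique hr0 fun j k hjk => ?_).trans (le_of_eq ?_)
          · by_cases hj : t ∈ A j
            · right
              rw [h2 k (Set.disjoint_left.1 (hA.disj j k hjk) hj), smul_zero]
            · left; rw [h2 j hj, smul_zero]
          · refine Finset.sum_congr rfl fun k _ => ?_
            rw [enorm_smul, ENNReal.mul_rpow_of_nonneg _ _ hr0.le]
      _ = ∑ k, ‖d k‖ₑ ^ r * ‖v k‖ₑ ^ r := by
          rw [lintegral_finsetSum' _ fun k _ => by fun_prop]
          refine Finset.sum_congr rfl fun k _ => ?_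
          rw [lintegral_const_mul'' _ (by fun_prop), ← Lp_enorm_rpow hr0]
      _ ≤ ∑ k, ‖d k‖ₑ ^ r := by
          refine Finset.sum_le_sum fun k _ => ?_
          rw [← ofReal_norm (v k), hvn, ENNReal.ofReal_one, ENNReal.one_rpow, mul_one]
  · rw [_root_.smul_apply, map_smul, hev]
    split_ifs with h
    · subst h
      rw [smul_eq_mul, smul_eq_mul, ← Complex.ofReal_mul, ← Complex.ofReal_mul, ← Complex.ofReal_one]
      congr 1
      rw [← Real.rpow_add_one (hm j).ne', ← Real.rpow_add (hm j)]
      simp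
    · simp

end Lr

/-! ### Nearly isometric copies of `ℓ^2` in `ℓ^s` -/

theorem exists_unitary_invariant_measure (n : ℕ) (i₀ : Fin n) :
    ∃ ν : Measure (EuclideanSpace ℂ (Fin n)), IsFiniteMeasure ν ∧
      (∀ᵐ u ∂ν, ‖u‖ ≤ 1) ∧
      (∀ b : OrthonormalBasis (Fin n) ℂ (EuclideanSpace ℂ (Fin n)),
        MeasurePreserving b.repr ν ν) ∧
      ¬ ∀ᵐ u ∂ν, u i₀ = 0 := by
  let _ : InnerProductSpace ℝ (EuclideanSpace ℂ (Fin n)) := InnerProductSpace.rclikeToReal ℂ _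
  have hfd : FiniteDimensional ℝ (EuclideanSpace ℂ (Fin n)) := FiniteDimensional.trans ℝ ℂ _
  let _ : MeasureSpace (EuclideanSpace ℂ (Fin n)) := measureSpaceOfInnerProductSpace
  -- Lebesgue measure on the unit ball, with `ℂⁿ` viewed as a real Euclidean space; unitary maps are
  -- real isometries and preserve both measure and ball.
  refine ⟨volume.restrict (Metric.ball 0 1), ?_, ?_, fun b => ?_, fun h => ?_⟩
  · exact ⟨by rw [Measure.restrict_apply_univ]; exact measure_ball_lt_top⟩
  · refine (ae_restrict_mem Metric.isOpen_ball.measurableSet).mono fun u hu => ?_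
    exact (mem_ball_zero_iff.1 hu).le
  · let U : EuclideanSpace ℂ (Fin n) ≃ₗᵢ[ℝ] EuclideanSpace ℂ (Fin n) :=
      { b.repr.toLinearEquiv.restrictScalars ℝ with norm_map' := b.repr.norm_map }
    have hU := U.measurePreserving.restrict_preimage
      (Metric.isOpen_ball (x := (0 : EuclideanSpace ℂ (Fin n))) (ε := 1)).measurableSet
    rw [LinearIsometryEquiv.preimage_ball, map_zero] at hU
    exact hU
  · rw [ae_restrict_iff' Metric.isOpen_ball.measurableSet, ae_iff] at h
    set O : Set (EuclideanSpace ℂ (Fin n)) := Metric.ball 0 1 ∩ {u | u i₀ ≠ 0} with hO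
    have hOo : IsOpen O := Metric.isOpen_ball.inter
      (isOpen_ne_fun (by fun_prop) continuous_const)
    have h0 : volume O = 0 := by
      convert h using 2
      ext u
      simp [hO]
    rw [hOo.measure_eq_zero_iff volume] at h0
    have : (EuclideanSpace.single i₀ (1 / 2 : ℂ)) ∈ O := by
      refine ⟨?_, ?_⟩
      · rw [mem_ball_zero_iff, PiLp.norm_single]; norm_num
      · simp
    rw [h0] at this
    exact this

/-- Extend `x/‖x‖` to an orthonormal basis with `b i₀ = x/‖x‖`; invariance then turns `⟨x, u⟩` into
`‖x‖` times a fixed coordinate. -/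
theorem eLpNorm_inner_eq {n : ℕ} {i₀ : Fin n} {ν : Measure (EuclideanSpace ℂ (Fin n))}
    (hν : ∀ b : OrthonormalBasis (Fin n) ℂ (EuclideanSpace ℂ (Fin n)),
      MeasurePreserving b.repr ν ν) (s : ℝ≥0∞) (x : EuclideanSpace ℂ (Fin n)) :
    eLpNorm (fun u => inner ℂ x u) s ν
      = ‖x‖ₑ * eLpNorm (fun u : EuclideanSpace ℂ (Fin n) => u i₀) s ν := by
  by_cases hx : x = 0
  · simp [hx]
  have hxn : (‖x‖ : ℂ) ≠ 0 := by exact_mod_cast norm_ne_zero_iff.2 hx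
  obtain ⟨b, hb⟩ := Orthonormal.exists_orthonormalBasis_extension_of_card_eq (𝕜 := ℂ)
    (E := EuclideanSpace ℂ (Fin n)) (ι := Fin n) (by simp)
    (v := fun _ => ((‖x‖ : ℂ)⁻¹) • x) (s := {i₀}) (by
      refine ⟨fun i => ?_, fun i j hij => absurd (Subsingleton.elim i j) hij⟩
      simp [Set.domRestrict, norm_smul, inv_mul_cancel₀ (norm_ne_zero_iff.2 hx)])
  have hb0 : b i₀ = ((‖x‖ : ℂ)⁻¹) • x := hb i₀ rfl
  have hx2 : x = (‖x‖ : ℂ) • b i₀ := by rw [hb0, smul_smul, mul_inv_cancel₀ hxn, one_smul]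
  have e : (fun u => inner ℂ x u)
      = (‖x‖ : ℂ) • ((fun u : EuclideanSpace ℂ (Fin n) => u i₀) ∘ b.repr) := by
    funext u
    simp only [Pi.smul_apply, Function.comp_apply, b.repr_apply_apply, smul_eq_mul]
    conv_lhs => rw [hx2]
    rw [inner_smul_left, Complex.conj_ofReal]
  rw [e, eLpNorm_const_smul, eLpNorm_comp_measurePreserving
    (Continuous.aestronglyMeasurable (by fun_prop)) (hν b)]
  congr 1
  rw [← ofReal_norm, Complex.norm_real, norm_norm, ofReal_norm]

theorem SimpleFunc_eLpNorm_comp {α β F : Type*} [MeasurableSpace α] [NormedAddCommGroup F]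
    {ν : Measure α} {s : ℝ} (hs : 0 < s) (g : SimpleFunc α β) (φ : β → F) :
    eLpNorm (fun u => φ (g u)) (ENNReal.ofReal s) ν
      = (∑ y ∈ g.range, ‖φ y‖ₑ ^ s * ν (g ⁻¹' {y})) ^ (1 / s) := by
  rw [eLpNorm_eq_lintegral_rpow_enorm_toReal (by simpa using hs) ENNReal.ofReal_ne_top,
    ENNReal.toReal_ofReal hs.le, ← SimpleFunc.map_lintegral (fun y => ‖φ y‖ₑ ^ s),
    ← SimpleFunc.lintegral_eq_lintegral]
  rfl

/-- The map `x ↦ ⟨x, ·⟩` is a multiple of an isometry into `L^s(ν)`. Replacing the identity on `ℂⁿ`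
by a simple function `g` lands in a weighted `ℓ^s` over the finite range of `g`, at a small
multiplicative cost. -/
theorem exists_approx_isometry_matrix {s : ℝ} (hs : 1 ≤ s) (n : ℕ) {δ : ℝ} (hδ0 : 0 < δ)
    (hδ1 : δ < 1) :
    ∃ (N : ℕ) (a : Fin n → Fin N → ℂ),
      (∀ c : Fin n → ℂ, (∑ k, ‖∑ i, c i * a i k‖ ^ s) ^ (1 / s)
        ≤ (∑ i, ‖c i‖ ^ (2 : ℝ)) ^ (1 / (2 : ℝ))) ∧
      ∀ i, δ ≤ (∑ k, ‖a i k‖ ^ s) ^ (1 / s) := by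
  have hs0 : 0 < s := by linarith
  rcases Nat.eq_zero_or_pos n with rfl | hn
  · refine ⟨0, fun _ _ => 0, fun c => ?_, fun i => i.elim0⟩
    simp [Real.zero_rpow (inv_ne_zero hs0.ne')]
  let i₀ : Fin n := ⟨0, hn⟩
  obtain ⟨ν, hfin, hball, hinv, hne⟩ := exists_unitary_invariant_measure n i₀
  set p : ℝ≥0∞ := ENNReal.ofReal s with hp
  have hp1 : 1 ≤ p := by rw [hp, ← ENNReal.ofReal_one]; exact ENNReal.ofReal_le_ofReal hs
  have hp0 : p ≠ 0 := (zero_lt_one.trans_le hp1).ne'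
  have hid : MemLp (fun u : EuclideanSpace ℂ (Fin n) => u) p ν :=
    MemLp.of_bound continuous_id.aestronglyMeasurable 1 hball
  set M := eLpNorm (fun u : EuclideanSpace ℂ (Fin n) => u i₀) p ν with hM
  have hMmem : MemLp (fun u : EuclideanSpace ℂ (Fin n) => u i₀) p ν :=
    hid.mono (Continuous.aestronglyMeasurable (by fun_prop))
      (Filter.Eventually.of_forall fun u => PiLp.norm_apply_le u i₀)
  have hMtop : M ≠ ∞ := hMmem.eLpNorm_ne_top
  have hM0 : M ≠ 0 := fun h => hne ((eLpNorm_eq_zero_iff hMmem.1 hp0).1 h)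
  set m := M.toReal with hm
  have hmpos : 0 < m := ENNReal.toReal_pos hM0 hMtop
  have hMm : M = ENNReal.ofReal m := (ENNReal.ofReal_toReal hMtop).symm
  -- Chosen so that `(1 - η)/(1 + η) = δ`, the ratio of the lower to the upper constant.
  set η := (1 - δ) / (1 + δ) with hη
  have hη0 : 0 < η := div_pos (by linarith) (by linarith)
  have hηδ : (1 - η) = δ * (1 + η) := by rw [hη]; field_simp; ring
  obtain ⟨g, hg, hgmem⟩ := hid.exists_simpleFunc_eLpNorm_sub_lt ENNReal.ofReal_ne_top
    (ε := ENNReal.ofReal (η * m)) (by simpa using mul_pos hη0 hmpos)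
  -- the functional `inner x ∘ g` on the approximating simple function
  have hinner : ∀ x : EuclideanSpace ℂ (Fin n),
      AEStronglyMeasurable (fun u => inner ℂ x u) ν := fun x =>
    Continuous.aestronglyMeasurable (by fun_prop)
  have hdiff : ∀ x : EuclideanSpace ℂ (Fin n),
      eLpNorm (fun u => inner ℂ x (u - g u)) p ν ≤ ENNReal.ofReal (‖x‖ * (η * m)) := fun x => by
    have h1 : eLpNorm (fun u => inner ℂ x (u - g u)) p ν
        ≤ ENNReal.ofReal ‖x‖ * eLpNorm ((fun u => u) - ⇑g) p ν :=
      eLpNorm_le_mul_eLpNorm_of_ae_le_mul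
        (Filter.Eventually.of_forall fun u => norm_inner_le_norm x (u - g u)) p
    rw [ENNReal.ofReal_mul (norm_nonneg x)]
    exact h1.trans (mul_le_mul_right hg.le _)
  have hdm : ∀ x : EuclideanSpace ℂ (Fin n),
      AEStronglyMeasurable (fun u => inner ℂ x (u - g u)) ν := fun x => by
    have : AEStronglyMeasurable (fun u => u - g u) ν :=
      continuous_id.aestronglyMeasurable.sub g.aestronglyMeasurable
    exact (innerSL ℂ x).continuous.comp_aestronglyMeasurable this
  have hgm : ∀ x : EuclideanSpace ℂ (Fin n),
      AEStronglyMeasurable (fun u => inner ℂ x (g u)) ν := fun x =>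
    (innerSL ℂ x).continuous.comp_aestronglyMeasurable g.aestronglyMeasurable
  have hup : ∀ x : EuclideanSpace ℂ (Fin n),
      eLpNorm (fun u => inner ℂ x (g u)) p ν ≤ ENNReal.ofReal (‖x‖ * (1 + η) * m) := fun x => by
    have h1 : (fun u => (inner ℂ x (g u) : ℂ))
        = (fun u => inner ℂ x u) - fun u => inner ℂ x (u - g u) := by
      funext u; simp
    rw [h1]
    refine (eLpNorm_sub_le (hinner x) (hdm x) hp1).trans ?_
    rw [eLpNorm_inner_eq (i₀ := i₀) hinv, ← hM, hMm, ← ofReal_norm, ← ENNReal.ofReal_mul (norm_nonneg x)]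
    refine (add_le_add le_rfl (hdiff x)).trans ?_
    rw [← ENNReal.ofReal_add (by positivity) (by positivity)]
    exact ENNReal.ofReal_le_ofReal (le_of_eq (by ring))
  have hlow : ∀ x : EuclideanSpace ℂ (Fin n), ENNReal.ofReal (‖x‖ * m)
      ≤ eLpNorm (fun u => inner ℂ x (g u)) p ν + ENNReal.ofReal (‖x‖ * (η * m)) := fun x => by
    have h1 : (fun u => (inner ℂ x u : ℂ))
        = (fun u => inner ℂ x (g u)) + fun u => inner ℂ x (u - g u) := by
      funext u; simp
    have h2 := eLpNorm_inner_eq (i₀ := i₀) hinv p x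
    rw [← hM, hMm, ← ofReal_norm, ← ENNReal.ofReal_mul (norm_nonneg x)] at h2
    rw [← h2]
    conv_lhs => rw [h1]
    exact (eLpNorm_add_le (hgm x) (hdm x) hp1).trans (add_le_add le_rfl (hdiff x))
  -- the weights
  set w : EuclideanSpace ℂ (Fin n) → ℝ := fun y => ν.real (g ⁻¹' {y}) with hw
  have hsum : ∀ x : EuclideanSpace ℂ (Fin n), eLpNorm (fun u => inner ℂ x (g u)) p ν
      = ENNReal.ofReal ((∑ y ∈ g.range, ‖(inner ℂ x y : ℂ)‖ ^ s * w y) ^ (1 / s)) := fun x => by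
    rw [hp, SimpleFunc_eLpNorm_comp hs0 g fun y => (inner ℂ x y : ℂ),
      ← ENNReal.ofReal_rpow_of_nonneg (Finset.sum_nonneg fun y _ => by positivity) (by positivity),
      ENNReal.ofReal_sum_of_nonneg fun y _ => by positivity]
    congr 1
    refine Finset.sum_congr rfl fun y _ => ?_
    rw [ENNReal.ofReal_mul (by positivity), ← ENNReal.ofReal_rpow_of_nonneg (norm_nonneg _) hs0.le,
      ofReal_norm, hw, ofReal_measureReal]
  -- Normalises the upper constant to one.
  set κ := ((1 + η) * m)⁻¹ with hκ
  have hκ0 : 0 < κ := by positivity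
  let y : Fin g.range.card → EuclideanSpace ℂ (Fin n) := fun k => (g.range.equivFin.symm k : _)
  have hval : ∀ x : EuclideanSpace ℂ (Fin n),
      (∑ k, ‖(inner ℂ x (y k) : ℂ) * ((κ * w (y k) ^ (1 / s) : ℝ) : ℂ)‖ ^ s) ^ (1 / s)
        = κ * (∑ y ∈ g.range, ‖(inner ℂ x y : ℂ)‖ ^ s * w y) ^ (1 / s) := fun x => by
    have hS : 0 ≤ ∑ y ∈ g.range, ‖(inner ℂ x y : ℂ)‖ ^ s * w y :=
      Finset.sum_nonneg fun y _ => by positivity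
    have h1 : ∀ k, ‖(inner ℂ x (y k) : ℂ) * ((κ * w (y k) ^ (1 / s) : ℝ) : ℂ)‖ ^ s
        = κ ^ s * (‖(inner ℂ x (y k) : ℂ)‖ ^ s * w (y k)) := fun k => by
      have hwk : 0 ≤ w (y k) := measureReal_nonneg
      rw [norm_mul, Complex.norm_real, Real.norm_eq_abs, abs_of_nonneg (by positivity),
        Real.mul_rpow (norm_nonneg _) (by positivity), Real.mul_rpow hκ0.le (by positivity),
        ← Real.rpow_mul hwk, one_div_mul_cancel hs0.ne', Real.rpow_one]
      ring
    have h2 : ∑ k, ‖(inner ℂ x (y k) : ℂ)‖ ^ s * w (y k)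
        = ∑ y ∈ g.range, ‖(inner ℂ x y : ℂ)‖ ^ s * w y := by
      rw [← Finset.sum_coe_sort g.range]
      exact Equiv.sum_comp g.range.equivFin.symm
        (fun z : g.range => ‖(inner ℂ x (z : EuclideanSpace ℂ (Fin n)) : ℂ)‖ ^ s * w z)
    simp only [h1]
    rw [← Finset.mul_sum, h2, Real.mul_rpow (by positivity) hS, ← Real.rpow_mul hκ0.le,
      mul_one_div_cancel hs0.ne', Real.rpow_one]
  refine ⟨g.range.card, fun i k => y k i * ((κ * w (y k) ^ (1 / s) : ℝ) : ℂ), fun c => ?_,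
    fun i => ?_⟩
  -- Conjugation compensates for the inner product being conjugate-linear in its first argument.
  · set x : EuclideanSpace ℂ (Fin n) := WithLp.toLp 2 fun i => (starRingEnd ℂ) (c i) with hx
    have h1 : ∀ k, ∑ i, c i * (y k i * ((κ * w (y k) ^ (1 / s) : ℝ) : ℂ))
        = (inner ℂ x (y k) : ℂ) * ((κ * w (y k) ^ (1 / s) : ℝ) : ℂ) := fun k => by
      rw [PiLp.inner_apply, Finset.sum_mul]
      refine Finset.sum_congr rfl fun i _ => ?_
      simp [hx]; ring
    have h2 : (∑ i, ‖c i‖ ^ (2 : ℝ)) ^ (1 / (2 : ℝ)) = ‖x‖ := by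
      rw [EuclideanSpace.norm_eq, Real.sqrt_eq_rpow]
      simp [hx]
    simp only [h1]
    rw [hval, h2]
    have h3 := hup x
    rw [hsum, ENNReal.ofReal_le_ofReal_iff (by positivity)] at h3
    calc _ ≤ κ * (‖x‖ * (1 + η) * m) := mul_le_mul_of_nonneg_left h3 hκ0.le
      _ = ‖x‖ := by rw [hκ]; field_simp
  · set x : EuclideanSpace ℂ (Fin n) := EuclideanSpace.single i 1 with hx
    have hx1 : ‖x‖ = 1 := by simp [hx]
    have h1 : ∀ k, y k i = (inner ℂ x (y k) : ℂ) := fun k => by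
      simp [hx, EuclideanSpace.inner_single_left]
    simp only [h1]
    rw [hval]
    have h3 := hlow x
    rw [hsum, ← ENNReal.ofReal_add (by positivity) (by positivity),
      ENNReal.ofReal_le_ofReal_iff (by positivity), hx1] at h3
    have h4 : (1 - η) * m ≤ (∑ y ∈ g.range, ‖(inner ℂ x y : ℂ)‖ ^ s * w y) ^ (1 / s) := by linarith
    calc δ = κ * ((1 - η) * m) := by rw [hκ, hηδ]; field_simp
      _ ≤ _ := mul_le_mul_of_nonneg_left h4 hκ0.le

/-! ### The main theorem -/

section Lr

variable {Ω : Type*} [MeasurableSpace Ω] {μ : Measure Ω} {r : ℝ} [Fact (1 ≤ ENNReal.ofReal r)]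

theorem hasWeakSummingSystems_Lp_of_matrix
    (hdim : ¬ FiniteDimensional ℂ (Lp ℂ (ENNReal.ofReal r) μ)) {s τ σ : ℝ}
    (hrs : r.HolderConjugate s) (hτσ : τ.HolderConjugate σ)
    (h : ∀ (n : ℕ) (δ : ℝ), 0 < δ → δ < 1 → ∃ (N : ℕ) (a : Fin n → Fin N → ℂ),
      (∀ c : Fin n → ℂ, (∑ k, ‖∑ i, c i * a i k‖ ^ s) ^ (1 / s)
        ≤ (∑ i, ‖c i‖ ^ σ) ^ (1 / σ)) ∧
      ∀ i, δ ≤ (∑ k, ‖a i k‖ ^ s) ^ (1 / s)) :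
    HasWeakSummingSystems (Lp ℂ (ENNReal.ofReal r) μ) τ := by
  intro n δ hδ0 hδ1
  have hr0 : 0 < r := hrs.pos
  obtain ⟨N, a, ha, haδ⟩ := h n δ hδ0 hδ1
  obtain ⟨e, v, he, hv, hev⟩ := exists_lr_biorthogonal (μ := μ) hrs.lt.le hdim N
  choose u hu1 hu2 using fun (i : Fin n) (k : Fin N) => exists_phase (a i k)
  -- Extremisers in Hölder: `g i` lies in the unit ball of `ℓ^r` and pairs with `|a i|` to its full
  -- `ℓ^s` norm. With the phases `u` it gives the test vectors.
  choose g hg1 hg2 using fun i : Fin n =>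
    (NNReal.isGreatest_Lp Finset.univ (fun k => ‖a i k‖₊) hrs.symm).1
  refine ⟨fun i => ∑ k, a i k • e k, fun i => ∑ k, (u i k * (g i k : ℝ)) • v k, ?_, fun i => ?_,
    fun i => ?_⟩
  · refine weakSummingNorm_le_one_of_norm_sum_smul_le hτσ fun c => ?_
    refine le_trans ?_ (ha c)
    refine ContinuousLinearMap.opNorm_le_bound _ (by positivity) fun f => ?_
    have e1 : (∑ i, c i • ∑ k, a i k • e k) f = ∑ k, (∑ i, c i * a i k) * e k f := by
      simp only [_root_.sum_apply, _root_.smul_apply, smul_eq_mul, Finset.mul_sum, Finset.sum_mul]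
      rw [Finset.sum_comm]
      exact Finset.sum_congr rfl fun _ _ => Finset.sum_congr rfl fun _ _ => by ring
    rw [e1]
    refine (norm_sum_le _ _).trans ?_
    simp only [norm_mul]
    refine (Real.inner_le_Lp_mul_Lq_of_nonneg Finset.univ hrs.symm (fun _ _ => norm_nonneg _)
      (fun _ _ => norm_nonneg _)).trans (mul_le_mul_of_nonneg_left ?_ (by positivity))
    calc (∑ k, ‖e k f‖ ^ r) ^ (1 / r) ≤ (‖f‖ ^ r) ^ (1 / r) :=
          Real.rpow_le_rpow (by positivity) (he f) (by positivity)
      _ = ‖f‖ := by rw [← Real.rpow_mul (norm_nonneg f), mul_one_div_cancel hr0.ne', Real.rpow_one]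
  · rw [← Real.rpow_le_rpow_iff (norm_nonneg _) zero_le_one hr0, Real.one_rpow]
    refine (hv _).trans ?_
    calc ∑ k, ‖u i k * ((g i k : ℝ) : ℂ)‖ ^ r ≤ ∑ k, (g i k : ℝ) ^ r := by
          refine Finset.sum_le_sum fun k _ => Real.rpow_le_rpow (norm_nonneg _) ?_ hr0.le
          rw [norm_mul, Complex.norm_real, Real.norm_eq_abs, abs_of_nonneg (NNReal.coe_nonneg _)]
          exact mul_le_of_le_one_left (g i k).2 (hu1 i k)
      _ ≤ 1 := by exact_mod_cast hg1 i
  · have e2 : (∑ k, a i k • e k) (∑ k, (u i k * ((g i k : ℝ) : ℂ)) • v k)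
        = ((∑ k, ‖a i k‖ * (g i k : ℝ) : ℝ) : ℂ) := by
      simp only [_root_.sum_apply, _root_.smul_apply, map_sum, map_smul, hev, smul_eq_mul, mul_ite,
        mul_one, mul_zero, Finset.sum_ite_eq', Finset.mem_univ, if_true, Complex.ofReal_sum,
        Complex.ofReal_mul, ← hu2]
      exact Finset.sum_congr rfl fun _ _ => by ring
    have e3 : ∑ k, ‖a i k‖ * (g i k : ℝ) = (∑ k, ‖a i k‖ ^ s) ^ (1 / s) := by
      have := congrArg (fun z : ℝ≥0 => (z : ℝ)) (hg2 i)
      simpa using this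
    rw [e2, Complex.norm_real, Real.norm_eq_abs, e3]
    exact (haδ i).trans (le_abs_self _)

theorem hasWeakSummingSystems_Lp (hr : 1 < r)
    (hdim : ¬ FiniteDimensional ℂ (Lp ℂ (ENNReal.ofReal r) μ)) :
    HasWeakSummingSystems (Lp ℂ (ENNReal.ofReal r) μ) (min r 2) := by
  have hrs := Real.HolderConjugate.conjExponent hr
  have hs := hrs.symm.pos
  rcases le_total r 2 with hr2 | hr2
  · rw [min_eq_left hr2]
    -- For `r ≤ 2` the identity matrix suffices, since `τ = r` and `σ = s`.
    refine hasWeakSummingSystems_Lp_of_matrix hdim hrs hrs fun n δ _ hδ1 =>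
      ⟨n, fun i k => if i = k then 1 else 0, fun c => ?_, fun i => ?_⟩
    · simp
    · rw [Finset.sum_eq_single i (fun k _ hk => by simp [hk.symm, hs.ne']) (by simp)]
      simpa using hδ1.le
  · rw [min_eq_right hr2]
    exact hasWeakSummingSystems_Lp_of_matrix hdim hrs Real.HolderConjugate.two_two
      fun n δ hδ0 hδ1 => exists_approx_isometry_matrix hrs.symm.lt.le n hδ0 hδ1

theorem exists_hasRademacherType_Lp (hr : 1 < r) :
    ∃ T : ℝ, 0 < T ∧ (r = 2 → T = 1) ∧
      HasRademacherType (Lp ℂ (ENNReal.ofReal r) μ) (min r 2) T := by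
  -- The value `r = 2` must fall in the first branch, where the constant is one.
  rcases le_or_gt r 2 with hr2 | hr2
  · exact ⟨1, one_pos, fun _ => rfl, by
      rw [min_eq_left hr2]; exact hasRademacherType_Lp_of_le_two hr.le hr2⟩
  · obtain ⟨T, hT, h⟩ := exists_hasRademacherType_Lp_of_two_le (μ := μ) hr2.le
    exact ⟨T, hT, fun h2 => absurd h2 hr2.ne', by rwa [min_eq_right hr2.le]⟩

end Lr

theorem similarSeq_of_le_of_le {a b : ℕ → ℝ≥0∞} {T : ℝ} (hT : 0 < T)
    (h : ∀ n, 1 ≤ n → b n ≤ a n ∧ a n ≤ ENNReal.ofReal T * b n) : SimilarSeq a b := by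
  refine ⟨(T.toNNReal)⁻¹, 1, by simpa using hT, one_pos, fun n hn => ⟨?_, ?_⟩⟩
  · have h0 : T.toNNReal ≠ 0 := by simpa using hT
    rw [ENNReal.coe_inv h0]
    refine (mul_le_mul_right (h n hn).2 _).trans (le_of_eq ?_)
    rw [← mul_assoc]
    change ((T.toNNReal : ℝ≥0∞))⁻¹ * (T.toNNReal : ℝ≥0∞) * b n = b n
    rw [ENNReal.inv_mul_cancel (by exact_mod_cast h0) ENNReal.coe_ne_top, one_mul]
  · simpa using (h n hn).1

theorem mainTheorem6 {Ω : Type*} [MeasurableSpace Ω] (μ : Measure Ω)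
    (r : ℝ) (hr : 1 < r) [Fact (1 ≤ ENNReal.ofReal r)]
    (hdim : ¬ FiniteDimensional ℂ (Lp ℂ (ENNReal.ofReal r) μ))
    (p q : ℝ) (hp : 1 ≤ p) (hpq : p ≤ q) :
    (1 / min r 2 ≤ 1 / p - 1 / q →
      SimilarSeq (fun n => pqGrowth (Lp ℂ (ENNReal.ofReal r) μ) p q n) (fun _ => 1)) ∧
    (min r 2 ≤ p →
      ∀ n : ℕ, 1 ≤ n →
        pqGrowth (Lp ℂ (ENNReal.ofReal r) μ) p q n = (n : ℝ≥0∞) ^ (1 / q)) ∧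
    (1 / p - 1 / q ≤ 1 / min r 2 → p ≤ min r 2 →
      SimilarSeq (fun n => pqGrowth (Lp ℂ (ENNReal.ofReal r) μ) p q n)
        (fun n => (n : ℝ≥0∞) ^ (1 / min r 2 - 1 / p + 1 / q))) ∧
    (r = 2 →
      (1 / min r 2 ≤ 1 / p - 1 / q →
        ∀ n : ℕ, 1 ≤ n → pqGrowth (Lp ℂ (ENNReal.ofReal r) μ) p q n = 1) ∧
      (min r 2 ≤ p →
        ∀ n : ℕ, 1 ≤ n →
          pqGrowth (Lp ℂ (ENNReal.ofReal r) μ) p q n = (n : ℝ≥0∞) ^ (1 / q)) ∧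
      (1 / p - 1 / q ≤ 1 / min r 2 → p ≤ min r 2 →
        ∀ n : ℕ, 1 ≤ n →
          pqGrowth (Lp ℂ (ENNReal.ofReal r) μ) p q n =
            (n : ℝ≥0∞) ^ (1 / min r 2 - 1 / p + 1 / q))) := by
  have hp0 : 0 < p := by linarith
  have hq0 : 0 < q := by linarith
  have hτ0 : 0 < min r 2 := lt_min (by linarith) two_pos
  obtain ⟨T, hT, hT2, htype⟩ := exists_hasRademacherType_Lp (μ := μ) hr
  have hsys := hasWeakSummingSystems_Lp hr hdim
  have hnt : Nontrivial (Lp ℂ (ENNReal.ofReal r) μ) := by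
    by_contra hn
    rw [not_nontrivial_iff_subsingleton] at hn
    exact hdim inferInstance
  have h1 : 1 / min r 2 ≤ 1 / p - 1 / q → ∀ n : ℕ, 1 ≤ n →
      1 ≤ pqGrowth (Lp ℂ (ENNReal.ofReal r) μ) p q n ∧
      pqGrowth (Lp ℂ (ENNReal.ofReal r) μ) p q n ≤ ENNReal.ofReal T * 1 := fun h n hn =>
    ⟨one_le_pqGrowth hp0 hq0 hn, by
      rw [mul_one]; exact htype.pqGrowth_le hT.le hτ0 hp hq0 h n⟩
  have h2 : min r 2 ≤ p → ∀ n : ℕ, 1 ≤ n →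
      pqGrowth (Lp ℂ (ENNReal.ofReal r) μ) p q n = (n : ℝ≥0∞) ^ (1 / q) := fun h n hn =>
    le_antisymm (pqGrowth_le_rpow hp0 hq0 hn) (hsys.rpow_le_pqGrowth hτ0 h hq0 hn)
  have h3lt : 1 / p - 1 / q ≤ 1 / min r 2 → p < min r 2 → ∀ n : ℕ, 1 ≤ n →
      (n : ℝ≥0∞) ^ (1 / min r 2 - 1 / p + 1 / q) ≤ pqGrowth (Lp ℂ (ENNReal.ofReal r) μ) p q n ∧
      pqGrowth (Lp ℂ (ENNReal.ofReal r) μ) p q n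
        ≤ ENNReal.ofReal T * (n : ℝ≥0∞) ^ (1 / min r 2 - 1 / p + 1 / q) := fun h hlt n hn =>
    ⟨hsys.rpow_sub_le_pqGrowth hp0 hlt.le hq0 hn,
      htype.pqGrowth_le_rpow hT.le hp hlt hq0 h hn⟩
  -- At this endpoint the type estimate has infinite exponent, but the claimed power is `n^{1/q}`
  -- and case (ii) applies.
  have h3eq : p = min r 2 → ∀ n : ℕ, 1 ≤ n → pqGrowth (Lp ℂ (ENNReal.ofReal r) μ) p q n
      = (n : ℝ≥0∞) ^ (1 / min r 2 - 1 / p + 1 / q) := fun h n hn => by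
    rw [← h, sub_self, zero_add]
    exact h2 h.ge n hn
  refine ⟨fun h => similarSeq_of_le_of_le hT (h1 h), h2, fun h hle => ?_, fun hr2 => ⟨fun h n hn =>
    ?_, h2, fun h hle n hn => ?_⟩⟩
  · rcases hle.eq_or_lt with heq | hlt
    · exact similarSeq_of_le_of_le one_pos fun n hn => by simp [h3eq heq n hn]
    · exact similarSeq_of_le_of_le hT (h3lt h hlt)
  · refine le_antisymm ?_ (h1 h n hn).1
    simpa [hT2 hr2] using (h1 h n hn).2
  · rcases hle.eq_or_lt with heq | hlt
    · exact h3eq heq n hn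
    · refine le_antisymm ?_ (h3lt h hlt n hn).1
      simpa [hT2 hr2] using (h3lt h hlt n hn).2
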